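/- **Theorem (DRM-OffP-LR).** Let $\mathscr S,\mathscr A$ be finite, and consider an episodic MDP with transition probabilities $p(s'\mid s,a)$, reward $r:\mathscr S\times\mathscr A\times\mathscr S\to[-r_{\max},r_{\max}]$, $r_{\max}>0$, discount factor $\gamma\in(0,1)$, fixed initial state $S_0$ and absorbing terminal state $0\in\mathscr S$. For a stationary stochastic policy let $T=\min\{t: S_t=0\}$ be the episode length, where $A_t$ is drawn from the policy at $S_t$ and $S_{t+1}\sim p(\cdot\mid S_t,A_t)$. Let $R^\theta=\sum_{t=0}^{T-1}\gamma^t r(S_t,A_t,S_{t+1})$ be the return of an episode under the policy $\pi_\theta$, $\theta\in\mathbb R^d$, let $F_{R^\theta}$ be its CDF, and write $R^b$ for the return of an episode under a behaviour policy $b$. Put $M_r=r_{\max}/(1-\gamma)$. Let $g:[0,1]\to[0,1]$ be continuous and non-decreasing with $g(0)=0$, $g(1)=1$, and let $$\rho_g(\theta)=\int_{-M_r}^0\big(g(1-F_{R^\theta}(x))-1\big)\,dx+\int_0^{M_r}g(1-F_{R^\theta}(x))\,dx .$$ Assume: 1. (Proper policies) there is an integer $K>0$ with $\max_s\mathbb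 P(S_K\ne0\mid S_0=s,\pi_\theta)<1$ for all $\theta$, and there is an integer $K'>0$ with $\max_s\mathbb P(S_{K'}\ne0\mid S_0=s,b)<1$. 2. For all $s,a$: $\pi_\theta(a\mid s)>0$ for all $\theta$, the function $\theta\mapsto\log\pi_\theta(a\mid s)$ is twice differentiable, and $\|\nabla\log\pi_\theta(a\mid s)\|\le M_d$ (Euclidean norm) and $\|\nabla^2\log\pi_\theta(a\mid s)\|\le M_h$ (operator norm) for all $\theta$. 3. $g$ is twice differentiable on $(0,1)$ with $|g'|\le M_{g'}$ and $|g''|\le M_{g''}$ there. At the end points, $g'(0)$ and $g'(1)$ denote the one-sided derivatives (which then exist). 4. (Absolute continuity) $b(a\mid s)=0$ implies $\pi_\theta(a\mid s)=0$, for all $\theta,a,s$. 5. For episodes generated by $b$ from $S_0$, $T\le M_e$ almost surely, and for every $\theta$ the importance sampling ratio $\psi^\theta=\prod_{t=0}^{T-1}\frac{\pi_\theta(A_t\mid S_t)}{b(A_t\mid S_t)}$ satisfies $\psi^\theta\le M_s$ almost surely. From $m\ge1$ episodes generated by $b$, with returns $R^b_i$, ratios $\psi^\theta_i$, lengths $T^i$,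 states $S^i_t$ and actions $A^i_t$, form $$H^m(x)=\min\Big\{\tfrac1m\sum_{i=1}^m\mathbf 1\{R^b_i\le x\}\psi_i^\theta,\,1\Big\},\qquad \widehat\nabla H^m(x)=\tfrac1m\sum_{i=1}^m\mathbf 1\{R^b_i\le x\}\,\psi_i^\theta\sum_{t=0}^{T^i-1}\nabla\log\pi_\theta(A^i_t\mid S^i_t),$$ $$\widehat\nabla^H\rho_g(\theta)=-\int_{-M_r}^{M_r}g'(1-H^m(x))\,\widehat\nabla H^m(x)\,dx .$$ Let $\alpha>0$, $N\ge1$, let $\theta_0\in\mathbb R^d$ be arbitrary, and let $\theta_{k+1}=\theta_k+\alpha\widehat\nabla^H\rho_g(\theta_k)$ for $k=0,\dots,N-1$, where each iteration uses a fresh batch of $m$ episodes generated by $b$ and all $Nm$ episodes are independent. Let $R$ be uniform on $\{1,\dots,N\}$ and independent of the episodes. Then $\rho_g$ is differentiable, $\rho_g^*=\sup_\theta\rho_g(\theta)$ is finite, $\|\nabla\rho_g(\theta_R)\|^2$ is integrable, and $$\mathbb E\|\nabla\rho_g(\theta_R)\|^2\le\frac{2(\rho_g^*-\rho_g(\theta_0))}{N\alpha}+4M_r^2M_s^2M_e^2M_d^2\left(\alpha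 M_{g'}^2L_{\rho'}+\frac{8\,(e^2M_{g'}^2+M_{g''}^2M_s^2)}{m}\right),$$ where $L_{\rho'}=2M_rM_e\big(M_hM_{g'}+M_eM_d^2(M_{g'}+M_{g''})\big)$. -/

import Mathlib

open MeasureTheory ProbabilityTheory

noncomputable section

/-- A finite episodic Markov decision process: transition law `p(· | s, a)`, bounded reward
`r(s, a, s')`, discount factor in `(0, 1)`, fixed initial state, absorbing terminal state. -/
structure EpisodicMDP (S A : Type*) where
  trans : S → A → PMF S
  reward : S → A → S → ℝ
  rMax : ℝ
  rMax_pos : 0 < rMax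
  abs_reward_le : ∀ s a s', |reward s a s'| ≤ rMax
  discount : ℝ
  discount_pos : 0 < discount
  discount_lt_one : discount < 1
  init : S
  terminal : S
  absorbing : ∀ a, trans terminal a = PMF.pure terminal

/-- A stationary stochastic policy; `π s a` is the probability of action `a` in state `s`. -/
abbrev StochPolicy (S A : Type*) := S → PMF A

/-- A trajectory `(S₀, A₀), (S₁, A₁), …`. -/
abbrev Trajectory (S A : Type*) := ℕ → S × A

namespace EpisodicMDP

variable {S A : Type*}

section Law

variable [Finite S] [Finite A] [MeasurableSpace S] [MeasurableSingletonClass S]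
  [MeasurableSpace A] [MeasurableSingletonClass A]

/-- The law of `(s, A)` with `A ∼ π(· | s)`. -/
def actPMF (π : StochPolicy S A) (s : S) : PMF (S × A) := (π s).map (Prod.mk s)

/-- One step `(s, a) ↦ (s', a')` with `s' ∼ p(· | s, a)` and `a' ∼ π(· | s')`. -/
def stepKernel (M : EpisodicMDP S A) (π : StochPolicy S A) : Kernel (S × A) (S × A) where
  toFun x := ((M.trans x.1 x.2).bind (actPMF π)).toMeasure
  measurable' := Measurable.of_discrete

instance (M : EpisodicMDP S A) (π : StochPolicy S A) : IsMarkovKernel (M.stepKernel π) :=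
  ⟨fun x => inferInstanceAs
    (IsProbabilityMeasure ((M.trans x.1 x.2).bind (actPMF π)).toMeasure)⟩

/-- The law of the whole trajectory under the policy `π` when `S₀ = s`. -/
def law (M : EpisodicMDP S A) (π : StochPolicy S A) (s : S) : Measure (Trajectory S A) :=
  Kernel.trajMeasure (X := fun _ => S × A) (actPMF π s).toMeasure
    (fun n => (M.stepKernel π).comap
      (fun h : (i : Finset.Iic n) → S × A => h ⟨n, Finset.mem_Iic.2 le_rfl⟩)
      (measurable_pi_apply _))

end Law

/-- The trajectory reaches the terminal state. -/
def Terminates (M : EpisodicMDP S A) (τ : Trajectory S A) : Prop :=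
  ∃ t, (τ t).1 = M.terminal

/-- The episode length `T`: the first time at which the terminal state is reached. (It is used
only where the episode terminates almost surely.) -/
def len (M : EpisodicMDP S A) (τ : Trajectory S A) : ℕ := sInf {t | (τ t).1 = M.terminal}

/-- The cumulative discounted reward `∑_{t < T} γ^t r(S_t, A_t, S_{t+1})` of an episode. -/
def ret (M : EpisodicMDP S A) (τ : Trajectory S A) : ℝ :=
  ∑ t ∈ Finset.range (M.len τ),
    M.discount ^ t * M.reward (τ t).1 (τ t).2 (τ (t + 1)).1

/-- `M_r = r_max / (1 - γ)`. -/
def retBound (M : EpisodicMDP S A) : ℝ := M.rMax / (1 - M.discount)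

/-- The importance sampling ratio `∏_{t < T} π(A_t | S_t) / b(A_t | S_t)` of an episode. -/
def isRatio (M : EpisodicMDP S A) (π b : StochPolicy S A) (τ : Trajectory S A) : ℝ :=
  ∏ t ∈ Finset.range (M.len τ),
    (π (τ t).1 (τ t).2).toReal / (b (τ t).1 (τ t).2).toReal

section Law

variable [Finite S] [Finite A] [MeasurableSpace S] [MeasurableSingletonClass S]
  [MeasurableSpace A] [MeasurableSingletonClass A]

/-- The CDF of the cumulative discounted reward of an episode generated by `π`. -/
def retCDF (M : EpisodicMDP S A) (π : StochPolicy S A) (x : ℝ) : ℝ :=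
  (M.law π M.init).real {τ | M.ret τ ≤ x}

/-- The distortion risk measure of the cumulative discounted reward under `π`. -/
def drm (M : EpisodicMDP S A) (g : ℝ → ℝ) (π : StochPolicy S A) : ℝ :=
  (∫ x in (-M.retBound)..0, (g (1 - M.retCDF π x) - 1)) +
    ∫ x in 0..M.retBound, g (1 - M.retCDF π x)

end Law

section Estimate

variable {d m : ℕ}

/-- `∑_{t < T} ∇_θ log π_θ(A_t | S_t)` along an episode. -/
def score (M : EpisodicMDP S A) (π : EuclideanSpace ℝ (Fin d) → StochPolicy S A)
    (θ : EuclideanSpace ℝ (Fin d)) (τ : Trajectory S A) : EuclideanSpace ℝ (Fin d) :=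
  ∑ t ∈ Finset.range (M.len τ),
    gradient (fun η => Real.log (π η (τ t).1 (τ t).2).toReal) θ

/-- The importance-sampling estimate of the CDF of the cumulative reward under `π`, from `m`
episodes `τ` generated by `b`, clipped at `1`. -/
def cdfEst (M : EpisodicMDP S A) (π b : StochPolicy S A) (τ : Fin m → Trajectory S A)
    (x : ℝ) : ℝ :=
  min ((m : ℝ)⁻¹ * ∑ i, {σ | M.ret σ ≤ x}.indicator (M.isRatio π b) (τ i)) 1

/-- The importance-sampling estimate of the gradient of the CDF. -/
def gradCdfEst (M : EpisodicMDP S A) (π : EuclideanSpace ℝ (Fin d) → StochPolicy S A)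
    (b : StochPolicy S A) (θ : EuclideanSpace ℝ (Fin d)) (τ : Fin m → Trajectory S A)
    (x : ℝ) : EuclideanSpace ℝ (Fin d) :=
  (m : ℝ)⁻¹ • ∑ i, {σ | M.ret σ ≤ x}.indicator
    (fun σ => M.isRatio (π θ) b σ • M.score π θ σ) (τ i)

/-- The off-policy estimate of the gradient of the distortion risk measure. Here `g'` is the
derivative of `g` on `[0, 1]`, one-sided at the end points. -/
def drmGradEst (M : EpisodicMDP S A) (g : ℝ → ℝ)
    (π : EuclideanSpace ℝ (Fin d) → StochPolicy S A) (b : StochPolicy S A)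
    (θ : EuclideanSpace ℝ (Fin d)) (τ : Fin m → Trajectory S A) : EuclideanSpace ℝ (Fin d) :=
  -∫ x in (-M.retBound)..M.retBound,
    derivWithin g (Set.Icc 0 1) (1 - M.cdfEst (π θ) b τ x) • M.gradCdfEst π b θ τ x

/-- The iterates of DRM-OffP-LR with step size `α`, started at `θ₀`; iteration `k` uses the batch
`τ k` of `m` episodes generated by `b`. -/
def offPolicyIter (M : EpisodicMDP S A) (g : ℝ → ℝ)
    (π : EuclideanSpace ℝ (Fin d) → StochPolicy S A) (b : StochPolicy S A) (α : ℝ)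
    (θ₀ : EuclideanSpace ℝ (Fin d)) (τ : ℕ → Fin m → Trajectory S A) :
    ℕ → EuclideanSpace ℝ (Fin d)
  | 0 => θ₀
  | k + 1 =>
    offPolicyIter M g π b α θ₀ τ k +
      α • M.drmGradEst g π b (offPolicyIter M g π b α θ₀ τ k) (τ k)

end Estimate

end EpisodicMDP

/-- A distortion function: a continuous non-decreasing `g : [0, 1] → [0, 1]` with `g 0 = 0` and
`g 1 = 1`. -/
structure IsDistortion (g : ℝ → ℝ) : Prop where
  mapsTo : Set.MapsTo g (Set.Icc 0 1) (Set.Icc 0 1)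
  monotoneOn : MonotoneOn g (Set.Icc 0 1)
  map_zero : g 0 = 0
  map_one : g 1 = 1
  continuousOn : ContinuousOn g (Set.Icc 0 1)

/-- The constant `L_{ρ'} = 2 M_r M_e (M_h M_{g'} + M_e M_d² (M_{g'} + M_{g''}))`. -/
def drmLipConst (Mr Me Md Mh Mg' Mg'' : ℝ) : ℝ :=
  2 * Mr * Me * (Mh * Mg' + Me * Md ^ 2 * (Mg' + Mg''))

end

set_option linter.unusedSectionVars false

/-! The target policies charge every action, so by absolute continuity the behaviour policy `b` does
too, and episodes under `b` end by time `⌊Me⌋₊`. Everything therefore happens on the finite set of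
trajectory prefixes up to that time. The change of measure `integral_law_eq_integral_mul_prod`
writes the CDF of the return under `π θ` as a finite sum of importance ratios over these prefixes.
At a point `x`, the CDF and its estimates depend only on the set of prefixes with return at most
`x`, so the integrals over `x` are finite sums over sets of prefixes, with weights of total `2 M_r`.
This gives an `ImportanceModel`, in which no differentiation under an integral sign is needed.

In that model the gradient is Lipschitz with constant `L = gradLip` (`norm_gradValue_sub_le`), which
equals `drmLipConst`. The gradient estimate is biased, because `g'` is evaluated at an estimated
CDF, but only its mean square error matters. That error is of order `1 / m`
(`integral_norm_gradValueEst_sub_sq_le`): `g'` is bounded and Lipschitz, and the estimates of the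
CDF and of its gradient are empirical means, up to a harmless clipping.

If `α L ≤ 1`, the descent lemma gives `α ‖∇ρ(θ_k)‖² ≤ 2 (ρ(θ_{k+1}) - ρ(θ_k)) + α ‖error_k‖²`. Each
batch is independent of the current iterate, so the error bound survives expectation, and summing
over `k` telescopes. If `α L ≥ 1`, the crude bound `‖∇ρ‖ ≤ 2 M_r M_{g'} M_e M_d` is already below
the term of the claim that contains `α M_{g'}² L`. -/

noncomputable section

/-! ### Trajectory laws: one-step integration and change of measure -/

namespace EpisodicMDP

variable {S A : Type*}

/-- The trajectory that follows `e` up to time `n` and stays at `e n` from then on. -/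
def freeze {n : ℕ} (e : Finset.Iic n → S × A) : Trajectory S A :=
  fun t => e ⟨min t n, Finset.mem_Iic.2 (min_le_right t n)⟩

lemma freeze_frestrictLe {n t : ℕ} (ht : t ≤ n) (τ : Trajectory S A) :
    freeze (Preorder.frestrictLe (π := fun _ => S × A) n τ) t = τ t := by
  simp [freeze, ht]

lemma _root_.DependsOn.freeze_frestrictLe {β : Type*} {n : ℕ} {f : Trajectory S A → β}
    (hf : DependsOn f (Set.Iic n)) (τ : Trajectory S A) :
    f (freeze (Preorder.frestrictLe (π := fun _ => S × A) n τ)) = f τ :=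
  hf fun _ ht => EpisodicMDP.freeze_frestrictLe ht τ

section Law

variable [Fintype S] [Fintype A] [MeasurableSpace S] [MeasurableSingletonClass S]
  [MeasurableSpace A] [MeasurableSingletonClass A]

instance (M : EpisodicMDP S A) (π : StochPolicy S A) (s : S) :
    IsProbabilityMeasure (M.law π s) := by
  unfold law; infer_instance

lemma measurable_of_dependsOn {β : Type*} [MeasurableSpace β] {n : ℕ} {f : Trajectory S A → β}
    (hf : DependsOn f (Set.Iic n)) : Measurable f := by
  have h : f = (fun e => f (freeze e)) ∘ Preorder.frestrictLe (π := fun _ => S × A) n :=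
    funext fun τ => (hf.freeze_frestrictLe τ).symm
  rw [h]
  exact Measurable.of_discrete.comp (Preorder.measurable_frestrictLe n)

/-- There are finitely many prefixes, so such a function takes finitely many values. -/
lemma integrable_of_dependsOn {n : ℕ} {f : Trajectory S A → ℝ} (hf : DependsOn f (Set.Iic n))
    (μ : Measure (Trajectory S A)) [IsFiniteMeasure μ] : Integrable f μ := by
  obtain ⟨C, hC⟩ := (Set.finite_range fun e : Finset.Iic n → S × A => ‖f (freeze e)‖).bddAbove
  refine Integrable.of_bound (measurable_of_dependsOn hf).aestronglyMeasurable C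
    (ae_of_all _ fun τ => ?_)
  rw [← hf.freeze_frestrictLe τ]
  exact hC ⟨_, rfl⟩

open Classical in
lemma actPMF_apply (π : StochPolicy S A) (s : S) (x : S × A) :
    actPMF π s x = if x.1 = s then π s x.2 else 0 := by
  obtain ⟨s', a⟩ := x
  rw [actPMF, PMF.map_apply, tsum_fintype]
  by_cases h : s' = s
  · subst h; simp [Finset.sum_ite_eq]
  · simp [h]

lemma bind_actPMF_apply (M : EpisodicMDP S A) (π : StochPolicy S A) (x y : S × A) :
    ((M.trans x.1 x.2).bind (actPMF π)) y = M.trans x.1 x.2 y.1 * π y.1 y.2 := by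
  classical
  rw [PMF.bind_apply, tsum_fintype, Finset.sum_eq_single y.1]
  · simp [actPMF_apply]
  · intro s _ hs; simp [actPMF_apply, hs.symm]
  · simp

lemma integral_law_zero (M : EpisodicMDP S A) (π : StochPolicy S A) (s : S)
    {f : Trajectory S A → ℝ} (hf : DependsOn f (Set.Iic 0)) :
    ∫ τ, f τ ∂M.law π s = ∑ a, (π s a).toReal * f (fun _ => (s, a)) := by
  classical
  have h1 : ∫ τ, f τ ∂M.law π s = ∫ e, f (freeze e)
      ∂(M.law π s).map (Preorder.frestrictLe (π := fun _ => S × A) 0) := by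
    rw [integral_map (Preorder.measurable_frestrictLe 0).aemeasurable
      Measurable.of_discrete.aestronglyMeasurable]
    simp_rw [hf.freeze_frestrictLe]
  have h2 : (M.law π s).map (Preorder.frestrictLe (π := fun _ => S × A) 0) =
      (actPMF π s).toMeasure.map
        (MeasurableEquiv.piUnique (fun _ : Finset.Iic 0 => S × A)).symm := by
    rw [law, Kernel.trajMeasure, Measure.map_comp _ _ (Preorder.measurable_frestrictLe 0),
      Kernel.traj_map_frestrictLe_of_le le_rfl, Measure.deterministic_comp_eq_map]
    exact Measure.map_id
  rw [h1, h2, integral_map (by fun_prop) Measurable.of_discrete.aestronglyMeasurable,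
    PMF.integral_eq_sum, Fintype.sum_prod_type, Finset.sum_eq_single s]
  · refine Finset.sum_congr rfl fun a _ => ?_
    simp only [actPMF_apply, if_true, smul_eq_mul]
    congr 1
  · intro s' _ hs'
    simp [actPMF_apply, hs']
  · simp

/-- The one-step conditional expectation of a function of the trajectory. -/
lemma integral_law_succ (M : EpisodicMDP S A) (π : StochPolicy S A) (s : S) {n : ℕ}
    {f : Trajectory S A → ℝ} (hf : DependsOn f (Set.Iic (n + 1))) :
    ∫ τ, f τ ∂M.law π s = ∫ τ, ∑ s', (M.trans (τ n).1 (τ n).2 s').toReal *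
      ∑ a', (π s' a').toReal * f (Function.update τ (n + 1) (s', a')) ∂M.law π s := by
  classical
  set μ := M.law π s
  let F : (Finset.Iic n → S × A) × (S × A) → ℝ := fun p => f (Function.update (freeze p.1) (n + 1) p.2)
  have hupd : ∀ τ x, f (Function.update (freeze
      (Preorder.frestrictLe (π := fun _ => S × A) n τ)) (n + 1) x) =
      f (Function.update τ (n + 1) x) := by
    intro τ x
    refine hf fun t ht => ?_
    rcases eq_or_ne t (n + 1) with rfl | h
    · simp
    · have : t ≤ n := by have := Set.mem_Iic.1 ht; omega
      simp [h, freeze_frestrictLe this]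
  have h1 : ∫ τ, f τ ∂μ = ∫ p, F p
      ∂μ.map (fun τ => (Preorder.frestrictLe (π := fun _ => S × A) n τ, τ (n + 1))) := by
    rw [integral_map (by fun_prop) Measurable.of_discrete.aestronglyMeasurable]
    refine integral_congr_ae (ae_of_all _ fun τ => ?_)
    simp only [F, hupd, Function.update_eq_self]
  rw [h1]
  have h2 := Kernel.map_frestrictLe_trajMeasure_compProd_eq_map_trajMeasure (X := fun _ => S × A)
    (μ₀ := (actPMF π s).toMeasure) (κ := fun n => (M.stepKernel π).comap
      (fun h : (i : Finset.Iic n) → S × A => h ⟨n, Finset.mem_Iic.2 le_rfl⟩)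
      (measurable_pi_apply _)) (a := n)
  have h3 : μ.map (fun τ => (Preorder.frestrictLe (π := fun _ => S × A) n τ, τ (n + 1))) = _ :=
    h2.symm
  rw [h3, Measure.integral_compProd .of_finite, integral_map
    (Preorder.measurable_frestrictLe n).aemeasurable Measurable.of_discrete.aestronglyMeasurable]
  refine integral_congr_ae (ae_of_all _ fun τ => ?_)
  have h4 : ∀ e : Finset.Iic n → S × A, ((M.stepKernel π).comap
      (fun h : (i : Finset.Iic n) → S × A => h ⟨n, Finset.mem_Iic.2 le_rfl⟩)
      (measurable_pi_apply _)) e = ((M.trans (e ⟨n, Finset.mem_Iic.2 le_rfl⟩).1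
        (e ⟨n, Finset.mem_Iic.2 le_rfl⟩).2).bind (actPMF π)).toMeasure := fun e => rfl
  simp only [h4, PMF.integral_eq_sum, bind_actPMF_apply, F, hupd, Fintype.sum_prod_type,
    Finset.mul_sum, ENNReal.toReal_mul, smul_eq_mul, Preorder.frestrictLe_apply, mul_assoc]

/-- Almost surely, an episode never leaves the terminal state. -/
lemma ae_absorbing (M : EpisodicMDP S A) (π : StochPolicy S A) (s : S) :
    ∀ᵐ τ ∂M.law π s, ∀ t, (τ t).1 = M.terminal → (τ (t + 1)).1 = M.terminal := by
  classical
  rw [ae_all_iff]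
  intro n
  let f : Trajectory S A → ℝ := fun τ =>
    if (τ n).1 = M.terminal ∧ (τ (n + 1)).1 ≠ M.terminal then 1 else 0
  have hf : DependsOn f (Set.Iic (n + 1)) := fun τ τ' h => by
    simp only [f, h n (by simp), h (n + 1) (by simp)]
  have h0 : ∫ τ, f τ ∂M.law π s = 0 := by
    rw [integral_law_succ M π s hf]
    refine integral_eq_zero_of_ae (ae_of_all _ fun τ => ?_)
    refine Finset.sum_eq_zero fun s' _ => ?_
    by_cases ht : (τ n).1 = M.terminal
    · rw [ht, M.absorbing, PMF.pure_apply]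
      by_cases hs : s' = M.terminal
      · simp [f, hs]
      · simp [hs]
    · simp [f, ht]
  rw [integral_eq_zero_iff_of_nonneg (fun τ => by simp only [f]; split_ifs <;> simp)
    (integrable_of_dependsOn hf _)] at h0
  filter_upwards [h0] with τ hτ h1
  by_contra h2
  simp [f, h1, h2] at hτ

/-- The likelihood ratio of a state-action pair, `1` in the terminal state, where actions have
no effect. -/
def stepRatio (M : EpisodicMDP S A) (π b : StochPolicy S A) (x : S × A) : ℝ :=
  open Classical in
  if x.1 = M.terminal then 1 else (π x.1 x.2).toReal / (b x.1 x.2).toReal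

/-- A function of the trajectory that does not depend on the actions in the terminal state. -/
def IgnoresTerminal (M : EpisodicMDP S A) {β : Type*} (f : Trajectory S A → β) : Prop :=
  ∀ τ τ' : Trajectory S A, (∀ t, (τ t).1 = (τ' t).1) →
    (∀ t, (τ t).1 ≠ M.terminal → (τ t).2 = (τ' t).2) → f τ = f τ'

lemma sum_toReal_eq_one {α : Type*} [Fintype α] (p : PMF α) : ∑ a, (p a).toReal = 1 := by
  rw [← ENNReal.toReal_sum fun a _ => p.apply_ne_top a, ← tsum_fintype (L := .unconditional _), p.tsum_coe]
  simp

/-- Change of measure between two policies up to time `n`. -/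
lemma integral_law_eq_integral_mul_prod (M : EpisodicMDP S A) (π b : StochPolicy S A)
    (hb : ∀ s a, b s a ≠ 0) (s : S) (n : ℕ) :
    ∀ {f : Trajectory S A → ℝ}, DependsOn f (Set.Iic n) → M.IgnoresTerminal f →
    ∫ τ, f τ ∂M.law π s =
      ∫ τ, f τ * ∏ t ∈ Finset.range (n + 1), M.stepRatio π b (τ t) ∂M.law b s := by
  classical
  have hb' : ∀ s a, (b s a).toReal ≠ 0 := fun s a =>
    ENNReal.toReal_ne_zero.2 ⟨hb s a, (b s).apply_ne_top a⟩
  -- One-step change of measure. In the terminal state the ratio is set to `1`; there `F` is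
  -- constant, so its average is the same under both policies.
  have key : ∀ s' (F : A → ℝ), (s' = M.terminal → ∀ a a', F a = F a') →
      ∑ a, (π s' a).toReal * F a = ∑ a, (b s' a).toReal * (F a * M.stepRatio π b (s', a)) := by
    intro s' F hF
    by_cases hs : s' = M.terminal
    · obtain ⟨a₀, -⟩ := (b s').support_nonempty
      have h : ∀ p : PMF A, ∑ a, (p a).toReal * F a = F a₀ := fun p => by
        simp_rw [hF hs _ a₀, ← Finset.sum_mul, sum_toReal_eq_one, one_mul]
      simp only [stepRatio, hs, if_true, mul_one]
      rw [← hs, h, h]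
    · refine Finset.sum_congr rfl fun a _ => ?_
      simp only [stepRatio, hs, if_false]
      field_simp [hb' s' a]
  induction n with
  | zero =>
    intro f hf hi
    rw [integral_law_zero M π s hf, integral_law_zero M b s]
    · simp only [zero_add, Finset.range_one, Finset.prod_singleton]
      refine key s (fun a => f fun _ => (s, a)) fun hs a a' => hi _ _ (fun _ => rfl) ?_
      intro t ht; exact absurd hs ht
    · intro τ τ' h
      simp [hf h, h 0 (by simp)]
  | succ n ih =>
    intro f hf hi
    -- Integrating out step `n + 1` leaves a function of the first steps, to which the induction
    -- hypothesis applies; `key` then changes the policy in the inner sum, which supplies the last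
    -- factor of the product.
    rw [integral_law_succ M π s hf, ih, integral_law_succ M b s (n := n)
      (f := fun τ => f τ * ∏ t ∈ Finset.range (n + 1 + 1), M.stepRatio π b (τ t))]
    · refine integral_congr_ae (ae_of_all _ fun τ => ?_)
      simp only
      rw [Finset.sum_mul]
      refine Finset.sum_congr rfl fun s' _ => ?_
      rw [mul_assoc]
      congr 1
      rw [key s' (fun a => f (Function.update τ (n + 1) (s', a))), Finset.sum_mul]
      · refine Finset.sum_congr rfl fun a _ => ?_
        rw [Finset.prod_range_succ _ (n + 1), Function.update_self]
        have h : ∀ t ∈ Finset.range (n + 1), M.stepRatio π b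
            (Function.update τ (n + 1) (s', a) t) = M.stepRatio π b (τ t) := fun t ht => by
          rw [Function.update_of_ne (Finset.mem_range.1 ht).ne]
        rw [Finset.prod_congr rfl h]
        ring
      · intro hs a a'
        refine hi _ _ (fun t => ?_) fun t ht => ?_
        · rcases eq_or_ne t (n + 1) with rfl | h <;> simp [*]
        · rcases eq_or_ne t (n + 1) with rfl | h
          · simp [hs] at ht
          · simp [h]
    · intro τ τ' h
      simp only [hf h]
      congr 1
      refine Finset.prod_congr rfl fun t ht => ?_
      rw [h t (Set.mem_Iic.2 (by have := Finset.mem_range.1 ht; omega))]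
    · intro τ τ' h
      simp only
      rw [h n (by simp)]
      refine Finset.sum_congr rfl fun s' _ => ?_
      congr 1
      refine Finset.sum_congr rfl fun a _ => ?_
      congr 1
      refine hf fun t ht => ?_
      rcases eq_or_ne t (n + 1) with rfl | hne
      · simp
      · rw [Function.update_of_ne hne, Function.update_of_ne hne]
        exact h t (Set.mem_Iic.2 (by have := Set.mem_Iic.1 ht; omega))
    · intro τ τ' h1 h2
      simp only
      -- The conditional expectation still ignores actions in the terminal state, because absorption
      -- makes the transition there independent of the action.
      have htr : M.trans (τ n).1 (τ n).2 = M.trans (τ' n).1 (τ' n).2 := by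
        by_cases ht : (τ n).1 = M.terminal
        · rw [← h1 n, ht, M.absorbing, M.absorbing]
        · rw [← h1 n, ← h2 n ht]
      rw [htr]
      refine Finset.sum_congr rfl fun s' _ => ?_
      congr 1
      refine Finset.sum_congr rfl fun a _ => ?_
      congr 1
      refine hi _ _ (fun t => ?_) fun t ht => ?_
      · rcases eq_or_ne t (n + 1) with rfl | hne
        · simp
        · simp [hne, h1 t]
      · rcases eq_or_ne t (n + 1) with rfl | hne
        · simp
        · simp only [Function.update_of_ne hne] at ht ⊢
          exact h2 t ht

end Law

end EpisodicMDP

/-! ### Truncated episodes and importance sampling of the return -/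

namespace EpisodicMDP

variable {S A : Type*}

section Pathwise

variable (M : EpisodicMDP S A)

lemma len_congr {τ τ' : Trajectory S A} (h : ∀ t, (τ t).1 = (τ' t).1) : M.len τ = M.len τ' := by
  simp only [len, h]

lemma fst_ne_terminal_of_lt_len {τ : Trajectory S A} {t : ℕ} (ht : t < M.len τ) :
    (τ t).1 ≠ M.terminal :=
  Nat.notMem_of_lt_sInf ht

lemma fst_len {τ : Trajectory S A} (h : M.Terminates τ) : (τ (M.len τ)).1 = M.terminal :=
  Nat.sInf_mem (s := {t | (τ t).1 = M.terminal}) h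

lemma len_le {τ : Trajectory S A} {t : ℕ} (ht : (τ t).1 = M.terminal) : M.len τ ≤ t :=
  Nat.sInf_le ht

lemma ignoresTerminal_ret : M.IgnoresTerminal M.ret := by
  intro τ τ' h1 h2
  rw [ret, ret, ← M.len_congr h1]
  refine Finset.sum_congr rfl fun t ht => ?_
  rw [h2 t (M.fst_ne_terminal_of_lt_len (Finset.mem_range.1 ht)), h1, h1]

/-- The trajectory `τ` frozen at time `n`. -/
abbrev frozen (n : ℕ) (τ : Trajectory S A) : Trajectory S A :=
  freeze (Preorder.frestrictLe (π := fun _ => S × A) n τ)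

lemma len_freeze_le {n : ℕ} (e : Finset.Iic n → S × A) : M.len (freeze e) ≤ n := by
  by_cases h : M.Terminates (freeze e)
  · obtain ⟨t, ht⟩ := h
    refine (M.len_le (t := min t n) ?_).trans (min_le_right t n)
    simpa [freeze] using ht
  -- Without termination the length is the default value `sInf ∅ = 0`.
  · have : {t | (freeze e t).1 = M.terminal} = ∅ := by
      ext t; exact ⟨fun ht => h ⟨t, ht⟩, False.elim⟩
    simp [len, this]

variable {n : ℕ} {τ : Trajectory S A}

lemma len_frozen (h : ∃ t ≤ n, (τ t).1 = M.terminal) : M.len (frozen n τ) = M.len τ := by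
  obtain ⟨t, htn, ht⟩ := h
  have h1 := M.len_le ht
  refine le_antisymm (M.len_le ?_) (M.len_le ?_)
  · rw [frozen, freeze_frestrictLe (h1.trans htn)]
    exact M.fst_len ⟨t, ht⟩
  · have h2 : M.Terminates (frozen n τ) := ⟨t, by rwa [frozen, freeze_frestrictLe htn]⟩
    have h3 := M.fst_len h2
    rwa [frozen, freeze_frestrictLe (M.len_freeze_le _)] at h3

lemma frozen_eq_of_le_len (h : ∃ t ≤ n, (τ t).1 = M.terminal) {t : ℕ} (ht : t ≤ M.len τ) :
    frozen n τ t = τ t := by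
  obtain ⟨t', htn, ht'⟩ := h
  exact freeze_frestrictLe (ht.trans ((M.len_le ht').trans htn)) τ

lemma ret_frozen (h : ∃ t ≤ n, (τ t).1 = M.terminal) : M.ret (frozen n τ) = M.ret τ := by
  rw [ret, ret, M.len_frozen h]
  refine Finset.sum_congr rfl fun t ht => ?_
  have := Finset.mem_range.1 ht
  rw [M.frozen_eq_of_le_len h this.le, M.frozen_eq_of_le_len h this]

lemma isRatio_frozen (π b : StochPolicy S A) (h : ∃ t ≤ n, (τ t).1 = M.terminal) :
    M.isRatio π b (frozen n τ) = M.isRatio π b τ := by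
  rw [isRatio, isRatio, M.len_frozen h]
  refine Finset.prod_congr rfl fun t ht => ?_
  rw [M.frozen_eq_of_le_len h (Finset.mem_range.1 ht).le]

lemma score_frozen {d : ℕ} (π : EuclideanSpace ℝ (Fin d) → StochPolicy S A)
    (θ : EuclideanSpace ℝ (Fin d)) (h : ∃ t ≤ n, (τ t).1 = M.terminal) :
    M.score π θ (frozen n τ) = M.score π θ τ := by
  rw [score, score, M.len_frozen h]
  refine Finset.sum_congr rfl fun t ht => ?_
  rw [M.frozen_eq_of_le_len h (Finset.mem_range.1 ht).le]

/-- From time `T` on the state is terminal, where every factor is `1`. -/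
lemma prod_stepRatio_eq_isRatio (π b : StochPolicy S A) (h : ∃ t ≤ n, (τ t).1 = M.terminal)
    (habsorb : ∀ t, (τ t).1 = M.terminal → (τ (t + 1)).1 = M.terminal) :
    ∏ t ∈ Finset.range (n + 1), M.stepRatio π b (τ t) = M.isRatio π b τ := by
  classical
  obtain ⟨t', htn, ht'⟩ := h
  have hlen := M.len_le ht'
  have hT : ∀ t, M.len τ ≤ t → (τ t).1 = M.terminal := fun t ht =>
    Nat.le_induction (M.fst_len ⟨t', ht'⟩) (fun t _ => habsorb t) t ht
  rw [isRatio, ← Finset.prod_subset (s₁ := Finset.range (M.len τ))]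
  · refine Finset.prod_congr rfl fun t ht => ?_
    simp [stepRatio, M.fst_ne_terminal_of_lt_len (Finset.mem_range.1 ht)]
  · exact Finset.range_mono (by omega)
  · intro t _ ht
    simp [stepRatio, hT t (by simpa using ht)]

end Pathwise

section Law

variable [Fintype S] [Fintype A] [MeasurableSpace S] [MeasurableSingletonClass S]
  [MeasurableSpace A] [MeasurableSingletonClass A]
variable {M : EpisodicMDP S A} {π b : StochPolicy S A} {s : S} {n : ℕ}

lemma ignoresTerminal_comp_frozen {β : Type*} {f : Trajectory S A → β}
    (hf : M.IgnoresTerminal f) (n : ℕ) : M.IgnoresTerminal fun τ => f (frozen n τ) :=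
  fun _ _ h1 h2 => hf _ _ (fun _ => h1 _) fun _ => h2 _

lemma dependsOn_comp_frozen {β : Type*} (f : Trajectory S A → β) (n : ℕ) :
    DependsOn (fun τ => f (frozen n τ)) (Set.Iic n) := fun τ τ' h => by
  have : frozen n τ = frozen n τ' := funext fun t => h _ (by simp)
  simp only [this]

/-- If episodes generated by `b` terminate before `n`, then so do those generated by `π`. -/
lemma ae_terminates_of_behaviour (hb : ∀ s a, b s a ≠ 0)
    (hterm : ∀ᵐ τ ∂M.law b s, ∃ t ≤ n, (τ t).1 = M.terminal) (π : StochPolicy S A) :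
    ∀ᵐ τ ∂M.law π s, ∃ t ≤ n, (τ t).1 = M.terminal := by
  classical
  -- The indicator of non-termination vanishes almost surely under `b`, so its reweighted integral
  -- is zero whatever the ratios are.
  let f : Trajectory S A → ℝ := fun τ => if ∃ t ≤ n, (τ t).1 = M.terminal then 0 else 1
  have hf : DependsOn f (Set.Iic n) := fun τ τ' h => by
    have : (∃ t ≤ n, (τ t).1 = M.terminal) ↔ ∃ t ≤ n, (τ' t).1 = M.terminal :=
      exists_congr fun t => and_congr_right fun ht => by rw [h t ht]
    simp only [f, this]
  have h0 : ∫ τ, f τ ∂M.law π s = 0 := by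
    rw [integral_law_eq_integral_mul_prod M π b hb s n hf fun τ τ' h _ => by simp only [f, h]]
    refine integral_eq_zero_of_ae ?_
    filter_upwards [hterm] with τ hτ
    simp [f, hτ]
  rw [integral_eq_zero_iff_of_nonneg (fun τ => by simp only [f]; split_ifs <;> simp)
    (integrable_of_dependsOn hf _)] at h0
  filter_upwards [h0] with τ hτ
  by_contra h
  simp [f, h] at hτ

/-- Importance sampling for functions of the cumulative reward. -/
lemma integral_comp_ret (hb : ∀ s a, b s a ≠ 0)
    (hterm : ∀ᵐ τ ∂M.law b s, ∃ t ≤ n, (τ t).1 = M.terminal) (φ : ℝ → ℝ) :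
    ∫ τ, φ (M.ret τ) ∂M.law π s = ∫ τ, φ (M.ret τ) * M.isRatio π b τ ∂M.law b s := by
  have h1 : ∫ τ, φ (M.ret τ) ∂M.law π s = ∫ τ, φ (M.ret (frozen n τ)) ∂M.law π s := by
    refine integral_congr_ae ?_
    filter_upwards [ae_terminates_of_behaviour hb hterm π] with τ hτ
    rw [M.ret_frozen hτ]
  rw [h1, integral_law_eq_integral_mul_prod M π b hb s n
    (dependsOn_comp_frozen (fun τ => φ (M.ret τ)) n)
    (ignoresTerminal_comp_frozen (f := fun τ => φ (M.ret τ))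
      (fun τ τ' h h' => congrArg φ (M.ignoresTerminal_ret τ τ' h h')) n)]
  refine integral_congr_ae ?_
  filter_upwards [hterm, ae_absorbing M b s] with τ hτ habs
  rw [M.ret_frozen hτ, M.prod_stepRatio_eq_isRatio π b hτ habs]

/-- The law of the first `n + 1` steps of an episode. -/
def prefixLaw (M : EpisodicMDP S A) (π : StochPolicy S A) (s : S) (n : ℕ) :
    Measure (Finset.Iic n → S × A) :=
  (M.law π s).map (Preorder.frestrictLe (π := fun _ => S × A) n)

instance : IsProbabilityMeasure (M.prefixLaw π s n) :=
  Measure.isProbabilityMeasure_map (Preorder.measurable_frestrictLe n).aemeasurable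

lemma integral_comp_frozen (f : Trajectory S A → ℝ) :
    ∫ τ, f (frozen n τ) ∂M.law π s = ∑ e, (M.prefixLaw π s n).real {e} * f (freeze e) := by
  have h := integral_map (μ := M.law π s) (Preorder.measurable_frestrictLe n).aemeasurable
    (f := fun e => f (freeze e)) Measurable.of_discrete.aestronglyMeasurable
  rw [← h]
  exact integral_fintype .of_finite

lemma sum_prefixLaw_mul_isRatio (hb : ∀ s a, b s a ≠ 0)
    (hterm : ∀ᵐ τ ∂M.law b s, ∃ t ≤ n, (τ t).1 = M.terminal) (φ : ℝ → ℝ) :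
    ∫ τ, φ (M.ret τ) ∂M.law π s =
      ∑ e, (M.prefixLaw b s n).real {e} * (φ (M.ret (freeze e)) * M.isRatio π b (freeze e)) := by
  rw [integral_comp_ret hb hterm, ← integral_comp_frozen fun τ => φ (M.ret τ) * M.isRatio π b τ]
  refine integral_congr_ae ?_
  filter_upwards [hterm] with τ hτ
  rw [M.ret_frozen hτ, M.isRatio_frozen π b hτ]

lemma sum_prefixLaw_mul_isRatio_eq_one (hb : ∀ s a, b s a ≠ 0)
    (hterm : ∀ᵐ τ ∂M.law b s, ∃ t ≤ n, (τ t).1 = M.terminal) :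
    ∑ e, (M.prefixLaw b s n).real {e} * M.isRatio π b (freeze e) = 1 := by
  have h := sum_prefixLaw_mul_isRatio (π := π) hb hterm fun _ => 1
  simpa using h.symm

lemma retCDF_eq_sum (hb : ∀ s a, b s a ≠ 0)
    (hterm : ∀ᵐ τ ∂M.law b M.init, ∃ t ≤ n, (τ t).1 = M.terminal) (x : ℝ) :
    M.retCDF π x = ∑ e, (M.prefixLaw b M.init n).real {e} *
      {e | M.ret (freeze e) ≤ x}.indicator (fun e => M.isRatio π b (freeze e)) e := by
  classical
  have h := sum_prefixLaw_mul_isRatio (π := π) hb hterm ((Set.Iic x).indicator 1)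
  have h1 : M.retCDF π x = ∫ τ, (Set.Iic x).indicator 1 (M.ret τ) ∂M.law π M.init := by
    -- The event is replaced by its version for the truncated episode, which depends on finitely
    -- many steps and is thus measurable.
    have hmeas : MeasurableSet {τ : Trajectory S A | M.ret (frozen n τ) ≤ x} :=
      measurableSet_le (measurable_of_dependsOn (dependsOn_comp_frozen M.ret n)) measurable_const
    have hae := ae_terminates_of_behaviour hb hterm π
    rw [retCDF, measureReal_congr (t := {τ : Trajectory S A | M.ret (frozen n τ) ≤ x}),
      ← integral_indicator_one hmeas]
    · refine integral_congr_ae ?_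
      filter_upwards [hae] with τ hτ
      simp only [Set.indicator_apply, Set.mem_ofPred_eq, M.ret_frozen hτ, Set.mem_Iic, Pi.one_apply]
    · rw [Filter.eventuallyEq_set]
      filter_upwards [hae] with τ hτ
      simp only [M.ret_frozen hτ]
  rw [h1, h]
  refine Finset.sum_congr rfl fun e _ => ?_
  simp only [Set.indicator_apply, Set.mem_Iic, Set.mem_ofPred_eq, Pi.one_apply]
  split_ifs <;> simp

end Law

end EpisodicMDP

/-! ### The distortion function up to the end points -/

open Set Filter Topology in
/-- A distortion function with bounded first and second derivatives on `(0, 1)` is continuously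
differentiable up to the end points, with the same bounds. -/
lemma IsDistortion.derivWithin_bounds {g : ℝ → ℝ} {M₁ M₂ : ℝ} (hg : IsDistortion g)
    (hg1 : DifferentiableOn ℝ g (Ioo 0 1)) (hM1 : ∀ t ∈ Ioo (0 : ℝ) 1, |deriv g t| ≤ M₁)
    (hg2 : DifferentiableOn ℝ (deriv g) (Ioo 0 1))
    (hM2 : ∀ t ∈ Ioo (0 : ℝ) 1, |deriv (deriv g) t| ≤ M₂) :
    (∀ t ∈ Icc (0 : ℝ) 1, HasDerivWithinAt g (derivWithin g (Icc 0 1) t) (Icc 0 1) t) ∧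
    (∀ t ∈ Icc (0 : ℝ) 1, |derivWithin g (Icc 0 1) t| ≤ M₁) ∧
    ∀ t ∈ Icc (0 : ℝ) 1, ∀ s ∈ Icc (0 : ℝ) 1,
      |derivWithin g (Icc 0 1) t - derivWithin g (Icc 0 1) s| ≤ M₂ * |t - s| := by
  have hM2nn : 0 ≤ M₂ := (abs_nonneg _).trans (hM2 (1 / 2) (by norm_num))
  -- Bounded `g''` makes `g'` Lipschitz on the open interval, so it extends to a Lipschitz `h` on
  -- the line. The limits of `g'` at `0` and `1` are then the one-sided derivatives, and both bounds
  -- pass to the closure.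
  have hlip : LipschitzOnWith ⟨M₂, hM2nn⟩ (deriv g) (Ioo 0 1) :=
    (convex_Ioo 0 1).lipschitzOnWith_of_nnnorm_deriv_le
      (fun t ht => (hg2 t ht).differentiableAt (isOpen_Ioo.mem_nhds ht)) fun t ht => hM2 t ht
  obtain ⟨h, hh, heq⟩ := hlip.extend_real
  have hhc : Continuous h := hh.continuous
  have hder : ∀ t ∈ Icc (0 : ℝ) 1, HasDerivWithinAt g (h t) (Icc 0 1) t := by
    intro t ht
    rcases eq_endpoints_or_mem_Ioo_of_mem_Icc ht with rfl | rfl | ht'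
    · refine (hasDerivWithinAt_Ici_of_tendsto_deriv (s := Ioo 0 1) hg1
        ((hg.continuousOn 0 ht).mono Ioo_subset_Icc_self) (Ioo_mem_nhdsGT one_pos) ?_).mono
        Icc_subset_Ici_self
      refine (hhc.continuousWithinAt (s := Ioi 0) (x := 0)).tendsto.congr' ?_
      filter_upwards [Ioo_mem_nhdsGT (zero_lt_one' ℝ)] with x hx using (heq hx).symm
    · refine (hasDerivWithinAt_Iic_of_tendsto_deriv (s := Ioo 0 1) hg1
        ((hg.continuousOn 1 ht).mono Ioo_subset_Icc_self) (Ioo_mem_nhdsLT one_pos) ?_).mono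
        Icc_subset_Iic_self
      refine (hhc.continuousWithinAt (s := Iio 1) (x := 1)).tendsto.congr' ?_
      filter_upwards [Ioo_mem_nhdsLT (zero_lt_one' ℝ)] with x hx using (heq hx).symm
    · rw [← heq ht']
      exact ((hg1 t ht').differentiableAt (isOpen_Ioo.mem_nhds ht')).hasDerivAt.hasDerivWithinAt
  have hval : ∀ t ∈ Icc (0 : ℝ) 1, derivWithin g (Icc 0 1) t = h t := fun t ht =>
    (hder t ht).derivWithin (uniqueDiffOn_Icc one_pos t ht)
  refine ⟨fun t ht => hval t ht ▸ hder t ht, fun t ht => ?_, fun t ht s hs => ?_⟩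
  · rw [hval t ht]
    have hcl : t ∈ closure (Ioo (0 : ℝ) 1) := by rwa [closure_Ioo zero_ne_one]
    have hclosed : IsClosed {t | |h t| ≤ M₁} := isClosed_le hhc.abs continuous_const
    exact closure_minimal (fun s hs => by simpa [← heq hs] using hM1 s hs) hclosed hcl
  · rw [hval t ht, hval s hs]
    exact hh.dist_le_mul t s

/-! ### Integrals of functions of the sublevel set `{e | f e ≤ x}` -/

section Slices

variable {E : Type*} [Finite E]

/-- The length of the set of `x ∈ (a, b]` for which `{e | f e ≤ x} = c`. -/
def sliceLength (f : E → ℝ) (a b : ℝ) (c : Set E) : ℝ :=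
  (volume.restrict (Set.Ioc a b)).real {x | {e | f e ≤ x} = c}

lemma sliceLength_nonneg (f : E → ℝ) (a b : ℝ) (c : Set E) : 0 ≤ sliceLength f a b c :=
  measureReal_nonneg

lemma measurableSet_slice (f : E → ℝ) (c : Set E) : MeasurableSet {x | {e | f e ≤ x} = c} := by
  have : {x | {e | f e ≤ x} = c} = ⋂ e, {x | f e ≤ x ↔ e ∈ c} := by
    ext x; simp [Set.ext_iff]
  rw [this]
  refine MeasurableSet.iInter fun e => ?_
  by_cases h : e ∈ c
  · convert measurableSet_Ici (a := f e) using 1; ext; simp [h]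
  · convert measurableSet_Iio (a := f e) using 1; ext; simp [h]

lemma intervalIntegrable_slice {F : Type*} [NormedAddCommGroup F] (f : E → ℝ) (a b : ℝ)
    (φ : Set E → F) : IntervalIntegrable (fun x => φ {e | f e ≤ x}) volume a b := by
  let : MeasurableSpace (Set E) := ⊤
  have hmeas : Measurable fun x => {e | f e ≤ x} :=
    measurable_to_countable' fun c => measurableSet_slice f c
  have h : StronglyMeasurable fun x => φ {e | f e ≤ x} :=
    (StronglyMeasurable.of_discrete (f := φ)).comp_measurable hmeas
  obtain ⟨C, hC⟩ := (Set.finite_range fun c => ‖φ c‖).bddAbove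
  rw [intervalIntegrable_iff, IntegrableOn, Set.uIoc]
  exact Integrable.of_bound h.aestronglyMeasurable C (ae_of_all _ fun x => hC ⟨_, rfl⟩)

variable [Fintype (Set E)]

/-- A function of `x` that depends only on `{e | f e ≤ x}` takes finitely many values, and its
integral is a finite sum. -/
lemma integral_slice {F : Type*} [NormedAddCommGroup F] [NormedSpace ℝ F] [CompleteSpace F]
    (f : E → ℝ) {a b : ℝ} (hab : a ≤ b) (φ : Set E → F) :
    ∫ x in a..b, φ {e | f e ≤ x} = ∑ c, sliceLength f a b c • φ c := by
  let : MeasurableSpace (Set E) := ⊤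
  have hmeas : Measurable fun x => {e | f e ≤ x} :=
    measurable_to_countable' fun c => measurableSet_slice f c
  have hφ : ∀ μ : Measure (Set E), AEStronglyMeasurable φ μ := fun μ =>
    (StronglyMeasurable.of_discrete (f := φ)).aestronglyMeasurable
  rw [intervalIntegral.integral_of_le hab, ← integral_map hmeas.aemeasurable (hφ _),
    integral_fintype .of_finite]
  refine Finset.sum_congr rfl fun c _ => ?_
  rw [map_measureReal_apply hmeas .of_discrete]
  rfl

lemma sum_sliceLength (f : E → ℝ) {a b : ℝ} (hab : a ≤ b) :
    ∑ c, sliceLength f a b c = b - a := by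
  have := integral_slice f hab fun _ => (1 : ℝ)
  simpa using this.symm

end Slices

/-! ### Gradients, the descent lemma and one ascent step -/

section Smooth

variable {V : Type*} [NormedAddCommGroup V] [InnerProductSpace ℝ V] [CompleteSpace V]

/-- A derivative within `I` suffices since `1 - F` never leaves `I`; this covers values `0` and `1`
of the CDF, where `g` has only one-sided derivatives. -/
lemma HasGradientAt.comp_one_sub {g : ℝ → ℝ} {g' : ℝ} {F : V → ℝ} {F' θ : V} {I : Set ℝ}
    (hg : HasDerivWithinAt g g' I (1 - F θ)) (hF : HasGradientAt F F' θ)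
    (hI : ∀ η, 1 - F η ∈ I) : HasGradientAt (fun η => g (1 - F η)) (-(g' • F')) θ := by
  rw [hasGradientAt_iff_hasFDerivAt] at hF ⊢
  have h := hg.comp_hasFDerivAt θ (hF.const_sub 1) (.of_forall hI)
  refine h.congr_fderiv ?_
  ext v
  simp

lemma HasGradientAt.finset_sum_smul {ι : Type*} {s : Finset ι} {c : ι → ℝ} {f : ι → V → ℝ}
    {f' : ι → V} {θ : V} (h : ∀ i ∈ s, HasGradientAt (f i) (f' i) θ) :
    HasGradientAt (fun η => ∑ i ∈ s, c i * f i η) (∑ i ∈ s, c i • f' i) θ := by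
  rw [hasGradientAt_iff_hasFDerivAt]
  refine (HasFDerivAt.fun_sum fun i hi => (h i hi).hasFDerivAt.const_mul (c i)).congr_fderiv ?_
  simp

lemma norm_sub_le_of_hasGradientAt {f : V → ℝ} {f' : V → V} {C : ℝ}
    (hf : ∀ θ, HasGradientAt f (f' θ) θ) (hC : ∀ θ, ‖f' θ‖ ≤ C) (θ η : V) :
    |f θ - f η| ≤ C * ‖θ - η‖ :=
  convex_univ.norm_image_sub_le_of_norm_hasFDerivWithin_le
    (fun x _ => (hf x).hasFDerivAt.hasFDerivWithinAt) (fun x _ => by simpa using hC x)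
    (Set.mem_univ η) (Set.mem_univ θ)

/-- The descent lemma, for maximization. -/
lemma add_inner_sub_le_of_lipschitz_gradient {f : V → ℝ} {f' : V → V} {L : ℝ}
    (hf : ∀ θ, HasGradientAt f (f' θ) θ) (hL : ∀ θ η, ‖f' θ - f' η‖ ≤ L * ‖θ - η‖) (θ v : V) :
    f θ + inner ℝ (f' θ) v - L / 2 * ‖v‖ ^ 2 ≤ f (θ + v) := by
  -- The gap between `f` along the segment and its quadratic lower model, up to a constant; the
  -- Lipschitz bound makes its derivative nonnegative on `[0, 1]`.
  let φ : ℝ → ℝ := fun t => f (θ + t • v) - t * inner ℝ (f' θ) v + L / 2 * ‖v‖ ^ 2 * t ^ 2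
  have hφ : ∀ t, HasDerivAt φ (inner ℝ (f' (θ + t • v) - f' θ) v + L * ‖v‖ ^ 2 * t) t := by
    intro t
    have h1 : HasDerivAt (fun t : ℝ => θ + t • v) v t := by
      simpa using ((hasDerivAt_id t).smul_const v).const_add θ
    have h2 := (hf (θ + t • v)).hasFDerivAt.comp_hasDerivAt t h1
    have h3 := (h2.sub ((hasDerivAt_id t).mul_const (inner ℝ (f' θ) v))).add
      ((hasDerivAt_pow 2 t).const_mul (L / 2 * ‖v‖ ^ 2))
    refine h3.congr_deriv ?_
    simp [inner_sub_left]
    ring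
  have hmono : MonotoneOn φ (Set.Icc 0 1) := by
    refine monotoneOn_of_hasDerivWithinAt_nonneg (convex_Icc 0 1)
      (fun t _ => (hφ t).continuousAt.continuousWithinAt)
      (fun t _ => (hφ t).hasDerivWithinAt) fun t ht => ?_
    rw [interior_Icc] at ht
    have h1 := abs_le.1 (abs_real_inner_le_norm (f' (θ + t • v) - f' θ) v)
    have h2 := hL (θ + t • v) θ
    rw [add_sub_cancel_left, norm_smul, Real.norm_of_nonneg ht.1.le] at h2
    nlinarith [mul_le_mul_of_nonneg_right h2 (norm_nonneg v)]
  have h := hmono (Set.left_mem_Icc.2 zero_le_one) (Set.right_mem_Icc.2 zero_le_one) zero_le_one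
  simp only [φ, zero_smul, add_zero, one_smul, zero_mul, one_mul] at h
  linarith

/-- One step of approximate gradient ascent with step size at most `1 / L`. -/
lemma norm_gradient_sq_le_of_step {f : V → ℝ} {f' : V → V} {L α : ℝ}
    (hf : ∀ θ, HasGradientAt f (f' θ) θ) (hL : ∀ θ η, ‖f' θ - f' η‖ ≤ L * ‖θ - η‖)
    (hα : 0 ≤ α) (hαL : α * L ≤ 1) (θ v : V) :
    α * ‖f' θ‖ ^ 2 ≤ 2 * (f (θ + α • v) - f θ) + α * ‖v - f' θ‖ ^ 2 := by
  have h := add_inner_sub_le_of_lipschitz_gradient hf hL θ (α • v)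
  obtain ⟨e, rfl⟩ : ∃ e, v = f' θ + e := ⟨v - f' θ, by simp⟩
  rw [add_sub_cancel_left]
  rw [inner_smul_right, norm_smul, Real.norm_of_nonneg hα, mul_pow, norm_add_sq_real,
    inner_add_right, real_inner_self_eq_norm_sq] at h
  have h1 := abs_le.1 (abs_real_inner_le_norm (f' θ) e)
  set G := ‖f' θ‖
  set x := inner ℝ (f' θ) e
  -- With `v = f' θ + e`, what remains to be shown is `0 ≤ α (1 - α L) ‖f' θ + e‖²`, expanded in
  -- `G`, `x` and `‖e‖`.
  have hx : -(2 * x) ≤ G ^ 2 + ‖e‖ ^ 2 := by nlinarith [sq_nonneg (G - ‖e‖)]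
  have h3 : (1 - α * L) * (-(2 * x)) ≤ (1 - α * L) * (G ^ 2 + ‖e‖ ^ 2) :=
    mul_le_mul_of_nonneg_left hx (by linarith)
  have h4 := mul_le_mul_of_nonneg_left h3 hα
  linarith

end Smooth

/-- The mean square error of the empirical mean of `m` independent samples. -/
lemma integral_norm_sq_empirical_mean_sub_le {E W : Type*} [Fintype E] [MeasurableSpace E]
    [MeasurableSingletonClass E] [NormedAddCommGroup W] [InnerProductSpace ℝ W] [CompleteSpace W]
    [MeasurableSpace W] [BorelSpace W]
    (ν : Measure E) [IsProbabilityMeasure ν] (f : E → W) {K : ℝ} (hf : ∀ᵐ e ∂ν, ‖f e‖ ≤ K)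
    {m : ℕ} (hm : 0 < m) :
    ∫ y : Fin m → E, ‖(m : ℝ)⁻¹ • ∑ i, f (y i) - ∫ e, f e ∂ν‖ ^ 2 ∂Measure.pi (fun _ => ν) ≤
      K ^ 2 / m := by
  classical
  set z := ∫ e, f e ∂ν
  let h : E → W := fun e => f e - z
  have hm0 : (m : ℝ) ≠ 0 := by positivity
  have hz : ∫ e, h e ∂ν = 0 := by
    simp only [h]
    rw [integral_sub .of_finite .of_finite]
    simp [z]
  -- The variance is at most the second moment, so centring costs no factor.
  have hsq : ∫ e, ‖h e‖ ^ 2 ∂ν ≤ K ^ 2 := by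
    have h1 : ∫ e, ‖h e‖ ^ 2 ∂ν = ∫ e, (‖f e‖ ^ 2 - 2 * inner ℝ z (f e) + ‖z‖ ^ 2) ∂ν := by
      refine integral_congr_ae (ae_of_all _ fun e => ?_)
      simp only [h, norm_sub_sq_real, real_inner_comm]
    have h2 : ∫ e, inner ℝ z (f e) ∂ν = ‖z‖ ^ 2 := by
      rw [integral_inner (𝕜 := ℝ) .of_finite, real_inner_self_eq_norm_sq]
    have h3 : ∫ e, ‖f e‖ ^ 2 ∂ν ≤ ∫ _, K ^ 2 ∂ν := by
      refine integral_mono_ae .of_finite .of_finite ?_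
      filter_upwards [hf] with e he
      exact pow_le_pow_left₀ (norm_nonneg _) he 2
    rw [h1, integral_add .of_finite .of_finite, integral_sub .of_finite .of_finite,
      integral_const_mul, h2]
    simp only [integral_const, probReal_univ, one_smul] at h3 ⊢
    nlinarith [sq_nonneg ‖z‖]
  have hlaw : ∀ i : Fin m, MeasurePreserving (Function.eval i)
      (Measure.pi fun _ : Fin m => ν) ν := fun i => measurePreserving_eval _ i
  have hindep : iIndepFun (fun (i : Fin m) (y : Fin m → E) => y i)
      (Measure.pi fun _ : Fin m => ν) :=
    iIndepFun_pi (X := fun _ => id) fun _ => aemeasurable_id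
  have hint : ∀ i (F : E → ℝ), ∫ y : Fin m → E, F (y i) ∂Measure.pi (fun _ => ν) =
      ∫ e, F e ∂ν := fun i F => by
    exact (hlaw i).hasLaw.integral_comp (f := F) Measurable.of_discrete.aestronglyMeasurable
  have hint' : ∀ i, ∫ y : Fin m → E, h (y i) ∂Measure.pi (fun _ => ν) = 0 := fun i => by
    rw [← hz]
    exact (hlaw i).hasLaw.integral_comp (f := h) StronglyMeasurable.of_discrete.aestronglyMeasurable
  -- Independent centred vectors are orthogonal in mean, so only the `m` diagonal terms of the
  -- square survive.
  have hcross : ∀ i j, i ≠ j →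
      ∫ y : Fin m → E, inner ℝ (h (y i)) (h (y j)) ∂Measure.pi (fun _ => ν) = 0 := by
    intro i j hij
    have hi : IndepFun (fun y : Fin m → E => h (y i)) (fun y => h (y j))
        (Measure.pi fun _ : Fin m => ν) :=
      (hindep.indepFun hij).comp (φ := h) (ψ := h) .of_discrete .of_discrete
    have := hi.integral_bilin .of_finite .of_finite (innerSL ℝ)
    rw [hint', hint', map_zero] at this
    exact this
  have hexp : ∀ y : Fin m → E, ‖(m : ℝ)⁻¹ • ∑ i, f (y i) - z‖ ^ 2 =
      ((m : ℝ)⁻¹) ^ 2 * ∑ i, ∑ j, inner ℝ (h (y i)) (h (y j)) := by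
    intro y
    have : (m : ℝ)⁻¹ • ∑ i, f (y i) - z = (m : ℝ)⁻¹ • ∑ i, h (y i) := by
      simp only [h, Finset.sum_sub_distrib, smul_sub, Finset.sum_const, Finset.card_univ,
        Fintype.card_fin]
      rw [← Nat.cast_smul_eq_nsmul ℝ, smul_smul, inv_mul_cancel₀ hm0, one_smul]
    rw [this, norm_smul, mul_pow, ← real_inner_self_eq_norm_sq (∑ i, h (y i)), sum_inner]
    simp [inner_sum]
  simp_rw [hexp]
  rw [integral_const_mul, integral_finsetSum _ fun _ _ => .of_finite]
  have hrow : ∀ i, ∫ y : Fin m → E, ∑ j, inner ℝ (h (y i)) (h (y j)) ∂Measure.pi (fun _ => ν) ≤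
      K ^ 2 := by
    intro i
    rw [integral_finsetSum _ fun _ _ => .of_finite, Finset.sum_eq_single i
      (fun j _ hj => hcross i j hj.symm) (by simp)]
    simp_rw [real_inner_self_eq_norm_sq]
    rw [hint i fun e => ‖h e‖ ^ 2]
    exact hsq
  calc _ ≤ ((m : ℝ)⁻¹) ^ 2 * ∑ _i : Fin m, K ^ 2 := by
        gcongr with i; exact hrow i
    _ = K ^ 2 / m := by
        simp only [Finset.sum_const, Finset.card_univ, Fintype.card_fin, nsmul_eq_mul]
        field_simp

/-! ### The finite importance sampling model: smoothness and mean square error -/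

/-- Finitely many episodes `e` with weights, whose likelihood ratios depend smoothly on a
parameter, together with a distortion and weights for the sets of episodes. -/
structure ImportanceModel (E V : Type*) [Fintype E] [NormedAddCommGroup V]
    [InnerProductSpace ℝ V] [CompleteSpace V] where
  weight : E → ℝ
  weight_nonneg : ∀ e, 0 ≤ weight e
  sum_weight : ∑ e, weight e = 1
  ratio : V → E → ℝ
  ratio_nonneg : ∀ θ e, 0 ≤ ratio θ e
  sum_ratio : ∀ θ, ∑ e, weight e * ratio θ e = 1
  ratioBound : ℝ
  ratio_le : ∀ θ e, weight e ≠ 0 → ratio θ e ≤ ratioBound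
  score : V → E → V
  hasGradientAt_ratio : ∀ θ e, HasGradientAt (fun η => ratio η e) (ratio θ e • score θ e) θ
  scoreBound : ℝ
  norm_score_le : ∀ θ e, ‖score θ e‖ ≤ scoreBound
  differentiable_score : ∀ e, Differentiable ℝ fun θ => score θ e
  hessBound : ℝ
  norm_fderiv_score_le : ∀ θ e, ‖fderiv ℝ (fun η => score η e) θ‖ ≤ hessBound
  len : Set E → ℝ
  len_nonneg : ∀ c, 0 ≤ len c
  g : ℝ → ℝ
  g' : ℝ → ℝ
  hasDerivWithinAt_g : ∀ t ∈ Set.Icc (0 : ℝ) 1, HasDerivWithinAt g (g' t) (Set.Icc 0 1) t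
  derivBound : ℝ
  abs_g'_le : ∀ t ∈ Set.Icc (0 : ℝ) 1, |g' t| ≤ derivBound
  derivLip : ℝ
  abs_g'_sub_le : ∀ t ∈ Set.Icc (0 : ℝ) 1, ∀ s ∈ Set.Icc (0 : ℝ) 1,
    |g' t - g' s| ≤ derivLip * |t - s|

namespace ImportanceModel

variable {E V : Type*} [Fintype E] [NormedAddCommGroup V] [InnerProductSpace ℝ V] [CompleteSpace V]
  (Q : ImportanceModel E V)

/-- The probability of the set `c` of episodes under the parameter `θ`. -/
def cdf (θ : V) (c : Set E) : ℝ := ∑ e, Q.weight e * c.indicator (Q.ratio θ) e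

/-- The gradient of `cdf` in the parameter. -/
def gradCdf (θ : V) (c : Set E) : V :=
  ∑ e, Q.weight e • c.indicator (fun e => Q.ratio θ e • Q.score θ e) e

/-- The importance-sampling estimate of `cdf` from the episodes `y`, clipped at `1`. -/
def cdfEst {m : ℕ} (θ : V) (y : Fin m → E) (c : Set E) : ℝ :=
  min ((m : ℝ)⁻¹ * ∑ i, c.indicator (Q.ratio θ) (y i)) 1

/-- The importance-sampling estimate of `gradCdf` from the episodes `y`. -/
def gradCdfEst {m : ℕ} (θ : V) (y : Fin m → E) (c : Set E) : V :=
  (m : ℝ)⁻¹ • ∑ i, c.indicator (fun e => Q.ratio θ e • Q.score θ e) (y i)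

lemma indicator_ratio_nonneg (θ : V) (c : Set E) (e : E) : 0 ≤ c.indicator (Q.ratio θ) e :=
  Set.indicator_nonneg (fun e _ => Q.ratio_nonneg θ e) e

lemma indicator_ratio_le (θ : V) (c : Set E) (e : E) : c.indicator (Q.ratio θ) e ≤ Q.ratio θ e :=
  Set.indicator_le_self' (fun _ _ => Q.ratio_nonneg θ _) e

lemma one_sub_cdf_mem (θ : V) (c : Set E) : 1 - Q.cdf θ c ∈ Set.Icc (0 : ℝ) 1 := by
  have h0 : 0 ≤ Q.cdf θ c := Finset.sum_nonneg fun e _ =>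
    mul_nonneg (Q.weight_nonneg e) (Q.indicator_ratio_nonneg θ c e)
  have h1 : Q.cdf θ c ≤ 1 := by
    rw [← Q.sum_ratio θ]
    exact Finset.sum_le_sum fun e _ =>
      mul_le_mul_of_nonneg_left (Q.indicator_ratio_le θ c e) (Q.weight_nonneg e)
  constructor <;> linarith

lemma one_sub_cdfEst_mem {m : ℕ} (θ : V) (y : Fin m → E) (c : Set E) :
    1 - Q.cdfEst θ y c ∈ Set.Icc (0 : ℝ) 1 := by
  have h0 : 0 ≤ Q.cdfEst θ y c := le_min (mul_nonneg (by positivity)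
    (Finset.sum_nonneg fun i _ => Q.indicator_ratio_nonneg θ c (y i))) zero_le_one
  have h1 : Q.cdfEst θ y c ≤ 1 := min_le_right _ _
  constructor <;> linarith

/-- Clipping at `1` is 1-Lipschitz and fixes the true value, which is at most `1`, so it cannot
increase the error. -/
lemma abs_cdfEst_sub_le {m : ℕ} (θ : V) (y : Fin m → E) (c : Set E) :
    |Q.cdfEst θ y c - Q.cdf θ c| ≤
      |(m : ℝ)⁻¹ * ∑ i, c.indicator (Q.ratio θ) (y i) - Q.cdf θ c| := by
  have h1 := Q.one_sub_cdf_mem θ c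
  have h2 := abs_min_sub_min_le_max ((m : ℝ)⁻¹ * ∑ i, c.indicator (Q.ratio θ) (y i)) 1
    (Q.cdf θ c) 1
  rw [min_eq_left (by linarith [h1.1] : Q.cdf θ c ≤ 1)] at h2
  simpa [cdfEst] using h2

lemma hasGradientAt_cdf (θ : V) (c : Set E) :
    HasGradientAt (fun η => Q.cdf η c) (Q.gradCdf θ c) θ := by
  refine HasGradientAt.finset_sum_smul fun e _ => ?_
  by_cases h : e ∈ c
  · simpa [h] using Q.hasGradientAt_ratio θ e
  · simpa [h] using hasGradientAt_const θ (0 : ℝ)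

lemma norm_indicator_smul_le (θ : V) (c : Set E) (e : E) :
    ‖c.indicator (fun e => Q.ratio θ e • Q.score θ e) e‖ ≤ Q.ratio θ e * Q.scoreBound := by
  refine (norm_indicator_le_norm_self _ _).trans ?_
  rw [norm_smul, Real.norm_of_nonneg (Q.ratio_nonneg θ e)]
  exact mul_le_mul_of_nonneg_left (Q.norm_score_le θ e) (Q.ratio_nonneg θ e)

/-- The numbers `weight * ratio` form a probability vector. Deterministic bounds under the target
policy therefore do not involve `ratioBound`. -/
lemma norm_sum_weight_smul_le {W : Type*} [NormedAddCommGroup W] [NormedSpace ℝ W] (θ : V) {C : ℝ}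
    {f : E → W} (hf : ∀ e, ‖f e‖ ≤ Q.ratio θ e * C) : ‖∑ e, Q.weight e • f e‖ ≤ C := by
  calc ‖∑ e, Q.weight e • f e‖ ≤ ∑ e, Q.weight e * (Q.ratio θ e * C) :=
        norm_sum_le_of_le _ fun e _ => by
          rw [norm_smul, Real.norm_of_nonneg (Q.weight_nonneg e)]
          exact mul_le_mul_of_nonneg_left (hf e) (Q.weight_nonneg e)
    _ = C := by simp_rw [← mul_assoc]; rw [← Finset.sum_mul, Q.sum_ratio, one_mul]

lemma norm_gradCdf_le (θ : V) (c : Set E) : ‖Q.gradCdf θ c‖ ≤ Q.scoreBound :=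
  Q.norm_sum_weight_smul_le θ (Q.norm_indicator_smul_le θ c)

/-- The gradient of the ratio is ratio times score, so the derivative of `ratio • score` is the
ratio times (derivative of the score plus score ⊗ score). -/
lemma norm_gradCdf_sub_le (θ η : V) (c : Set E) :
    ‖Q.gradCdf θ c - Q.gradCdf η c‖ ≤ (Q.hessBound + Q.scoreBound ^ 2) * ‖θ - η‖ := by
  classical
  let f' : V → E → V →L[ℝ] V := fun θ e => if e ∈ c then
    Q.ratio θ e • fderiv ℝ (fun η => Q.score η e) θ +
      (innerSL ℝ (Q.ratio θ e • Q.score θ e)).smulRight (Q.score θ e) else 0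
  have hf' : ∀ θ e, HasFDerivAt (fun η => c.indicator (fun e => Q.ratio η e • Q.score η e) e)
      (f' θ e) θ := by
    intro θ e
    by_cases h : e ∈ c
    · simp only [f', h, if_true, Set.indicator_of_mem]
      exact (Q.hasGradientAt_ratio θ e).hasFDerivAt.smul
        (Q.differentiable_score e θ).hasFDerivAt
    · simpa only [f', h, if_false, Set.indicator_of_notMem, not_false_eq_true] using
        hasFDerivAt_const (0 : V) θ
  have hbound : ∀ θ e, ‖f' θ e‖ ≤ Q.ratio θ e * (Q.hessBound + Q.scoreBound ^ 2) := by
    intro θ e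
    have hr := Q.ratio_nonneg θ e
    have hs := Q.norm_score_le θ e
    have hh := Q.norm_fderiv_score_le θ e
    by_cases h : e ∈ c
    · simp only [f', h, if_true]
      refine (norm_add_le _ _).trans ?_
      rw [norm_smul, ContinuousLinearMap.norm_smulRight_apply, innerSL_apply_norm, norm_smul,
        Real.norm_of_nonneg hr, mul_add, mul_assoc, ← sq]
      gcongr
    · simp only [f', h, if_false, norm_zero]
      exact mul_nonneg hr (add_nonneg ((norm_nonneg _).trans hh) (sq_nonneg _))
  refine convex_univ.norm_image_sub_le_of_norm_hasFDerivWithin_le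
    (f := fun θ => Q.gradCdf θ c) (f' := fun θ => ∑ e, Q.weight e • f' θ e) (fun x _ => ?_)
    (fun x _ => Q.norm_sum_weight_smul_le x (hbound x)) (Set.mem_univ η) (Set.mem_univ θ)
  exact (HasFDerivAt.fun_sum fun e _ => (hf' x e).const_smul (Q.weight e)).hasFDerivWithinAt

lemma abs_cdf_sub_le (θ η : V) (c : Set E) :
    |Q.cdf θ c - Q.cdf η c| ≤ Q.scoreBound * ‖θ - η‖ :=
  norm_sub_le_of_hasGradientAt (fun θ => Q.hasGradientAt_cdf θ c)
    (fun θ => Q.norm_gradCdf_le θ c) θ η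

lemma scoreBound_nonneg (θ : V) : 0 ≤ Q.scoreBound :=
  (norm_nonneg _).trans (Q.norm_gradCdf_le θ ∅)

lemma derivBound_nonneg : 0 ≤ Q.derivBound :=
  (abs_nonneg _).trans (Q.abs_g'_le 0 (by simp))

lemma derivLip_nonneg : 0 ≤ Q.derivLip := by
  simpa using (abs_nonneg _).trans (Q.abs_g'_sub_le 1 (by simp) 0 (by simp))

/-- The weighted mean of the ratios is `1`, so their upper bound is at least `1`. -/
lemma one_le_ratioBound (θ : V) : 1 ≤ Q.ratioBound := by
  rw [← Q.sum_ratio θ, ← one_mul Q.ratioBound, ← Q.sum_weight, Finset.sum_mul]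
  refine Finset.sum_le_sum fun e _ => ?_
  by_cases h : Q.weight e = 0
  · simp [h]
  · exact mul_le_mul_of_nonneg_left (Q.ratio_le θ e h) (Q.weight_nonneg e)

variable [Fintype (Set E)]

/-- The sum of the weights of all sets of episodes. -/
def totalLen : ℝ := ∑ c, Q.len c

/-- The distorted objective. -/
def value (θ : V) : ℝ := ∑ c, Q.len c * Q.g (1 - Q.cdf θ c)

/-- The gradient of the objective. -/
def gradValue (θ : V) : V := ∑ c, Q.len c • -(Q.g' (1 - Q.cdf θ c) • Q.gradCdf θ c)

/-- The estimate of the gradient of the objective from the episodes `y`. -/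
def gradValueEst {m : ℕ} (θ : V) (y : Fin m → E) : V :=
  ∑ c, Q.len c • -(Q.g' (1 - Q.cdfEst θ y c) • Q.gradCdfEst θ y c)

lemma totalLen_nonneg : 0 ≤ Q.totalLen := Finset.sum_nonneg fun c _ => Q.len_nonneg c

lemma hasGradientAt_value (θ : V) : HasGradientAt Q.value (Q.gradValue θ) θ :=
  HasGradientAt.finset_sum_smul fun c _ =>
    HasGradientAt.comp_one_sub (Q.hasDerivWithinAt_g _ (Q.one_sub_cdf_mem θ c))
      (Q.hasGradientAt_cdf θ c)
      fun η => Q.one_sub_cdf_mem η c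

lemma norm_sum_len_smul_le {f : Set E → V} {C : ℝ} (hf : ∀ c, ‖f c‖ ≤ C) :
    ‖∑ c, Q.len c • f c‖ ≤ Q.totalLen * C := by
  rw [totalLen, Finset.sum_mul]
  refine norm_sum_le_of_le _ fun c _ => ?_
  rw [norm_smul, Real.norm_of_nonneg (Q.len_nonneg c)]
  exact mul_le_mul_of_nonneg_left (hf c) (Q.len_nonneg c)

lemma norm_gradValue_le (θ : V) :
    ‖Q.gradValue θ‖ ≤ Q.totalLen * (Q.derivBound * Q.scoreBound) := by
  refine Q.norm_sum_len_smul_le fun c => ?_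
  rw [norm_neg, norm_smul]
  exact mul_le_mul (Q.abs_g'_le _ (Q.one_sub_cdf_mem θ c)) (Q.norm_gradCdf_le θ c)
    (norm_nonneg _) Q.derivBound_nonneg

/-- The Lipschitz constant of the gradient. -/
def gradLip : ℝ := Q.totalLen *
  (Q.derivBound * (Q.hessBound + Q.scoreBound ^ 2) + Q.derivLip * Q.scoreBound ^ 2)

lemma gradLip_nonneg [Nonempty E] (θ : V) : 0 ≤ Q.gradLip := by
  have h : 0 ≤ Q.hessBound :=
    (norm_nonneg _).trans (Q.norm_fderiv_score_le θ (Classical.arbitrary E))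
  have := Q.totalLen_nonneg
  have := Q.derivBound_nonneg
  have := Q.derivLip_nonneg
  unfold gradLip
  positivity

/-- In each product `g' • gradCdf` the two factors are changed in turn: `g'` is bounded while
`gradCdf` is Lipschitz, and `gradCdf` is bounded while `g'` of the CDF is Lipschitz. -/
lemma norm_gradValue_sub_le (θ η : V) :
    ‖Q.gradValue θ - Q.gradValue η‖ ≤ Q.gradLip * ‖θ - η‖ := by
  rw [gradValue, gradValue, ← Finset.sum_sub_distrib, gradLip, mul_assoc]
  simp_rw [← smul_sub]
  refine Q.norm_sum_len_smul_le fun c => ?_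
  have h : -(Q.g' (1 - Q.cdf θ c) • Q.gradCdf θ c) - -(Q.g' (1 - Q.cdf η c) • Q.gradCdf η c) =
      -(Q.g' (1 - Q.cdf θ c) • (Q.gradCdf θ c - Q.gradCdf η c) +
        (Q.g' (1 - Q.cdf θ c) - Q.g' (1 - Q.cdf η c)) • Q.gradCdf η c) := by
    rw [smul_sub, sub_smul]; abel
  rw [h, norm_neg]
  refine (norm_add_le _ _).trans ?_
  rw [norm_smul, norm_smul, add_mul, mul_assoc]
  have h1 := Q.abs_g'_sub_le _ (Q.one_sub_cdf_mem θ c) _ (Q.one_sub_cdf_mem η c)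
  rw [sub_sub_sub_cancel_left, abs_sub_comm (Q.cdf η c)] at h1
  have h2 := h1.trans (mul_le_mul_of_nonneg_left (Q.abs_cdf_sub_le θ η c) Q.derivLip_nonneg)
  refine add_le_add (mul_le_mul (Q.abs_g'_le _ (Q.one_sub_cdf_mem θ c))
    (Q.norm_gradCdf_sub_le θ η c) (norm_nonneg _) Q.derivBound_nonneg) ?_
  calc _ ≤ Q.derivLip * (Q.scoreBound * ‖θ - η‖) * Q.scoreBound :=
        mul_le_mul h2 (Q.norm_gradCdf_le η c) (norm_nonneg _) ((abs_nonneg _).trans h2)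
    _ = _ := by ring

/-- Cauchy–Schwarz with weights `len`. -/
lemma norm_sum_len_smul_sq_le (f : Set E → V) :
    ‖∑ c, Q.len c • f c‖ ^ 2 ≤ Q.totalLen * ∑ c, Q.len c * ‖f c‖ ^ 2 := by
  have h : ‖∑ c, Q.len c • f c‖ ≤ ∑ c, Q.len c * ‖f c‖ := norm_sum_le_of_le _ fun c _ => by
    rw [norm_smul, Real.norm_of_nonneg (Q.len_nonneg c)]
  refine (pow_le_pow_left₀ (norm_nonneg _) h 2).trans ?_
  exact Finset.sum_sq_le_sum_mul_sum_of_sq_le_mul _ (fun c _ => Q.len_nonneg c)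
    (fun c _ => mul_nonneg (Q.len_nonneg c) (sq_nonneg _)) fun c _ => le_of_eq (by ring)

section MeanSquareError

variable [MeasurableSpace E] [MeasurableSingletonClass E] (ν : Measure E) [IsProbabilityMeasure ν]
  {m : ℕ}

lemma integral_norm_gradCdfEst_sub_sq_le (hν : ∀ e, ν.real {e} = Q.weight e) (hm : 0 < m)
    (θ : V) (c : Set E) :
    ∫ y : Fin m → E, ‖Q.gradCdfEst θ y c - Q.gradCdf θ c‖ ^ 2 ∂Measure.pi (fun _ => ν) ≤
      (Q.ratioBound * Q.scoreBound) ^ 2 / m := by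
  borelize V
  have hz : ∫ e, c.indicator (fun e => Q.ratio θ e • Q.score θ e) e ∂ν = Q.gradCdf θ c := by
    rw [integral_fintype .of_finite]
    simp_rw [hν]
    rfl
  rw [← hz]
  -- The ratio is bounded only at points of positive weight, which is enough almost everywhere.
  refine integral_norm_sq_empirical_mean_sub_le ν _ ((ae_iff_of_countable).2 fun e he => ?_) hm
  have hw : Q.weight e ≠ 0 := by
    rw [← hν]; exact ENNReal.toReal_ne_zero.2 ⟨he, measure_ne_top _ _⟩
  exact (Q.norm_indicator_smul_le θ c e).trans
    (mul_le_mul_of_nonneg_right (Q.ratio_le θ e hw) (Q.scoreBound_nonneg θ))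

lemma integral_empirical_cdf_sub_sq_le (hν : ∀ e, ν.real {e} = Q.weight e) (hm : 0 < m)
    (θ : V) (c : Set E) :
    ∫ y : Fin m → E, ((m : ℝ)⁻¹ * ∑ i, c.indicator (Q.ratio θ) (y i) - Q.cdf θ c) ^ 2
      ∂Measure.pi (fun _ => ν) ≤ Q.ratioBound ^ 2 / m := by
  have hz : ∫ e, c.indicator (Q.ratio θ) e ∂ν = Q.cdf θ c := by
    rw [integral_fintype .of_finite]
    simp_rw [hν]
    rfl
  have h := integral_norm_sq_empirical_mean_sub_le ν (c.indicator (Q.ratio θ))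
    (K := Q.ratioBound) ((ae_iff_of_countable).2 fun e he => ?_) hm
  · simpa [hz] using h
  · have hw : Q.weight e ≠ 0 := by
      rw [← hν]; exact ENNReal.toReal_ne_zero.2 ⟨he, measure_ne_top _ _⟩
    rw [Real.norm_of_nonneg (Q.indicator_ratio_nonneg θ c e)]
    exact (Q.indicator_ratio_le θ c e).trans (Q.ratio_le θ e hw)

/-- The split pairs the error in `g'` with the true `gradCdf`, bounded by `scoreBound`, and not with
its estimate. Hence no product of two correlated random errors appears. -/
lemma norm_slice_error_sq_le (θ : V) (y : Fin m → E) (c : Set E) :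
    ‖Q.g' (1 - Q.cdfEst θ y c) • Q.gradCdfEst θ y c - Q.g' (1 - Q.cdf θ c) • Q.gradCdf θ c‖ ^ 2 ≤
      2 * Q.derivBound ^ 2 * ‖Q.gradCdfEst θ y c - Q.gradCdf θ c‖ ^ 2 +
      2 * (Q.derivLip ^ 2 * Q.scoreBound ^ 2) *
        ((m : ℝ)⁻¹ * ∑ i, c.indicator (Q.ratio θ) (y i) - Q.cdf θ c) ^ 2 := by
  have h : Q.g' (1 - Q.cdfEst θ y c) • Q.gradCdfEst θ y c - Q.g' (1 - Q.cdf θ c) • Q.gradCdf θ c =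
      Q.g' (1 - Q.cdfEst θ y c) • (Q.gradCdfEst θ y c - Q.gradCdf θ c) +
        (Q.g' (1 - Q.cdfEst θ y c) - Q.g' (1 - Q.cdf θ c)) • Q.gradCdf θ c := by
    rw [smul_sub, sub_smul]; abel
  rw [h]
  set G := Q.gradCdfEst θ y c - Q.gradCdf θ c
  set x := (m : ℝ)⁻¹ * ∑ i, c.indicator (Q.ratio θ) (y i) - Q.cdf θ c
  have h1 : ‖Q.g' (1 - Q.cdfEst θ y c) • G‖ ≤ Q.derivBound * ‖G‖ := by
    rw [norm_smul]
    exact mul_le_mul_of_nonneg_right (Q.abs_g'_le _ (Q.one_sub_cdfEst_mem θ y c)) (norm_nonneg _)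
  have h2 : ‖(Q.g' (1 - Q.cdfEst θ y c) - Q.g' (1 - Q.cdf θ c)) • Q.gradCdf θ c‖ ≤
      Q.derivLip * |x| * Q.scoreBound := by
    rw [norm_smul]
    have h3 := Q.abs_g'_sub_le _ (Q.one_sub_cdfEst_mem θ y c) _ (Q.one_sub_cdf_mem θ c)
    rw [sub_sub_sub_cancel_left, abs_sub_comm (Q.cdf θ c)] at h3
    have h4 := h3.trans (mul_le_mul_of_nonneg_left (Q.abs_cdfEst_sub_le θ y c) Q.derivLip_nonneg)
    exact mul_le_mul h4 (Q.norm_gradCdf_le θ c) (norm_nonneg _) ((abs_nonneg _).trans h4)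
  calc _ ≤ (Q.derivBound * ‖G‖ + Q.derivLip * |x| * Q.scoreBound) ^ 2 :=
        pow_le_pow_left₀ (norm_nonneg _) ((norm_add_le _ _).trans (add_le_add h1 h2)) 2
    _ ≤ 2 * ((Q.derivBound * ‖G‖) ^ 2 + (Q.derivLip * |x| * Q.scoreBound) ^ 2) := add_sq_le
    _ = _ := by rw [mul_pow, mul_pow, mul_pow, sq_abs]; ring

/-- The mean square error of the gradient estimate from `m` independent episodes. -/
lemma integral_norm_gradValueEst_sub_sq_le (hν : ∀ e, ν.real {e} = Q.weight e) (hm : 0 < m)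
    (θ : V) :
    ∫ y : Fin m → E, ‖Q.gradValueEst θ y - Q.gradValue θ‖ ^ 2 ∂Measure.pi (fun _ => ν) ≤
      Q.totalLen ^ 2 * (2 * Q.ratioBound ^ 2 * Q.scoreBound ^ 2 *
        (Q.derivBound ^ 2 + Q.derivLip ^ 2) / m) := by
  set B := 2 * Q.ratioBound ^ 2 * Q.scoreBound ^ 2 * (Q.derivBound ^ 2 + Q.derivLip ^ 2) / m
  set μ := Measure.pi fun _ : Fin m => ν
  let u : Set E → (Fin m → E) → V := fun c y =>
    Q.g' (1 - Q.cdfEst θ y c) • Q.gradCdfEst θ y c - Q.g' (1 - Q.cdf θ c) • Q.gradCdf θ c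
  have hu : ∀ c, ∫ y, ‖u c y‖ ^ 2 ∂μ ≤ B := by
    intro c
    calc ∫ y, ‖u c y‖ ^ 2 ∂μ ≤ ∫ y, (2 * Q.derivBound ^ 2 *
          ‖Q.gradCdfEst θ y c - Q.gradCdf θ c‖ ^ 2 + 2 * (Q.derivLip ^ 2 * Q.scoreBound ^ 2) *
            ((m : ℝ)⁻¹ * ∑ i, c.indicator (Q.ratio θ) (y i) - Q.cdf θ c) ^ 2) ∂μ :=
          integral_mono .of_finite .of_finite fun y => Q.norm_slice_error_sq_le θ y c
      _ ≤ 2 * Q.derivBound ^ 2 * ((Q.ratioBound * Q.scoreBound) ^ 2 / m) +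
          2 * (Q.derivLip ^ 2 * Q.scoreBound ^ 2) * (Q.ratioBound ^ 2 / m) := by
          rw [integral_add .of_finite .of_finite, integral_const_mul, integral_const_mul]
          gcongr
          · exact Q.integral_norm_gradCdfEst_sub_sq_le ν hν hm θ c
          · exact Q.integral_empirical_cdf_sub_sq_le ν hν hm θ c
      _ = B := by simp only [B]; ring
  have hpt : ∀ y, ‖Q.gradValueEst θ y - Q.gradValue θ‖ ^ 2 ≤
      Q.totalLen * ∑ c, Q.len c * ‖u c y‖ ^ 2 := by
    intro y
    have h : Q.gradValueEst θ y - Q.gradValue θ = ∑ c, Q.len c • -u c y := by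
      rw [gradValueEst, gradValue, ← Finset.sum_sub_distrib]
      refine Finset.sum_congr rfl fun c _ => ?_
      rw [← smul_sub]
      congr 1
      simp only [u]
      abel
    rw [h]
    simpa using Q.norm_sum_len_smul_sq_le fun c => -u c y
  calc _ ≤ ∫ y, Q.totalLen * ∑ c, Q.len c * ‖u c y‖ ^ 2 ∂μ :=
        integral_mono .of_finite .of_finite hpt
    _ = Q.totalLen * ∑ c, Q.len c * ∫ y, ‖u c y‖ ^ 2 ∂μ := by
        rw [integral_const_mul, integral_finsetSum _ fun _ _ => .of_finite]
        simp_rw [integral_const_mul]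
    _ ≤ Q.totalLen * ∑ c, Q.len c * B := by
        refine mul_le_mul_of_nonneg_left (Finset.sum_le_sum fun c _ => ?_) Q.totalLen_nonneg
        exact mul_le_mul_of_nonneg_left (hu c) (Q.len_nonneg c)
    _ = _ := by rw [← Finset.sum_mul, totalLen]; ring

end MeanSquareError

end ImportanceModel

/-! ### Independence and random indices for finitely valued variables -/

section Discrete

variable {Ω α β : Type*} [MeasurableSpace Ω] {P : Measure Ω} [IsProbabilityMeasure P]
  [Finite α] [MeasurableSpace α] [MeasurableSingletonClass α]
  [Finite β] [MeasurableSpace β] [MeasurableSingletonClass β]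

lemma integrable_comp_of_finite {Z : Ω → α} (hZ : AEMeasurable Z P) (f : α → ℝ) :
    Integrable (fun ω => f (Z ω)) P :=
  (Integrable.of_finite (μ := P.map Z) (f := f)).comp_aemeasurable hZ

/-- By independence the joint law is a product, and Fubini allows `U` to be fixed. -/
lemma ProbabilityTheory.IndepFun.integral_le_of_forall_integral_le {U : Ω → α} {W : Ω → β}
    (hU : AEMeasurable U P) (hW : AEMeasurable W P) (h : IndepFun U W P) (F : α → β → ℝ) {B : ℝ}
    (hB : ∀ u, ∫ w, F u w ∂P.map W ≤ B) : ∫ ω, F (U ω) (W ω) ∂P ≤ B := by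
  have := Measure.isProbabilityMeasure_map hU
  have := Measure.isProbabilityMeasure_map hW
  have h1 : ∫ ω, F (U ω) (W ω) ∂P = ∫ p, F p.1 p.2 ∂P.map fun ω => (U ω, W ω) := by
    rw [integral_map (hU.prodMk hW) Measurable.of_discrete.aestronglyMeasurable]
  rw [h1, (indepFun_iff_map_prod_eq_prod_map_map hU hW).1 h, integral_prod _ .of_finite]
  calc _ ≤ ∫ _, B ∂P.map U := integral_mono .of_finite .of_finite hB
    _ = B := by simp

lemma ProbabilityTheory.HasLaw.ae_mem_Icc {a b : ℕ} {R : Ω → ℕ}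
    (hR : HasLaw R (uniformOn (Set.Icc a b)) P) : ∀ᵐ ω ∂P, R ω ∈ Set.Icc a b :=
  (hR.ae_iff (p := fun k => k ∈ Set.Icc a b) .of_discrete).2 (ae_cond_mem measurableSet_Icc)

/-- The expectation at an independent index that is uniform on `{1, …, N}`. -/
lemma integral_uniform_index {N : ℕ} {R : Ω → ℕ}
    (hR : HasLaw R (uniformOn (Set.Icc 1 N)) P) {Z : Ω → α} (hZ : AEMeasurable Z P)
    (h : IndepFun R Z P) (F : ℕ → α → ℝ) :
    Integrable (fun ω => F (R ω) (Z ω)) P ∧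
    ∫ ω, F (R ω) (Z ω) ∂P = (N : ℝ)⁻¹ * ∑ k ∈ Finset.Icc 1 N, ∫ ω, F k (Z ω) ∂P := by
  classical
  have hmem : ∀ᵐ ω ∂P, R ω ∈ Set.Icc 1 N := hR.ae_mem_Icc
  have hae : (fun ω => F (R ω) (Z ω)) =ᵐ[P] fun ω => ∑ k ∈ Finset.Icc 1 N,
      (({k} : Set ℕ).indicator (fun _ => (1 : ℝ)) (R ω)) * F k (Z ω) := by
    filter_upwards [hmem] with ω hω
    rw [Finset.sum_eq_single (R ω)]
    · simp
    · intro k _ hk; simp [hk.symm]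
    · intro hk; exact absurd (Finset.mem_Icc.2 hω) hk
  have hmeas : ∀ k : ℕ, AEStronglyMeasurable
      (fun ω => ({k} : Set ℕ).indicator (fun _ => (1 : ℝ)) (R ω)) P := fun k =>
    ((Measurable.of_discrete (f := ({k} : Set ℕ).indicator fun _ => (1 : ℝ))).comp_aemeasurable
      hR.aemeasurable).aestronglyMeasurable
  have hint : ∀ k, Integrable (fun ω => ({k} : Set ℕ).indicator (fun _ => (1 : ℝ)) (R ω) *
      F k (Z ω)) P := fun k =>
    (integrable_comp_of_finite hZ (F k)).bdd_mul (c := 1) (hmeas k) (ae_of_all _ fun ω => by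
      rw [Set.indicator_apply]; split_ifs <;> simp)
  have hprob : ∀ k ∈ Finset.Icc 1 N,
      ∫ ω, ({k} : Set ℕ).indicator (fun _ => (1 : ℝ)) (R ω) ∂P = (N : ℝ)⁻¹ := by
    intro k hk
    have h1 := hR.integral_comp (f := ({k} : Set ℕ).indicator fun _ => (1 : ℝ))
      Measurable.of_discrete.aestronglyMeasurable
    have h2 : uniformOn (Set.Icc 1 N) {k} = (N : ENNReal)⁻¹ := by
      have := uniformOn_apply_finset (s := Finset.Icc 1 N) (t := {k})
      rw [Finset.inter_singleton_of_mem hk] at this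
      simpa using this
    refine h1.trans ?_
    rw [integral_indicator_const _ (measurableSet_singleton k), measureReal_def, h2]
    simp
  refine ⟨(integrable_finsetSum _ fun k _ => hint k).congr hae.symm, ?_⟩
  rw [integral_congr_ae hae, integral_finsetSum _ fun k _ => hint k, Finset.mul_sum]
  refine Finset.sum_congr rfl fun k hk => ?_
  have hi : IndepFun (fun ω => ({k} : Set ℕ).indicator (fun _ => (1 : ℝ)) (R ω))
      (fun ω => F k (Z ω)) P :=
    h.comp (φ := ({k} : Set ℕ).indicator fun _ => (1 : ℝ)) (ψ := F k) .of_discrete .of_discrete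
  rw [hi.integral_fun_mul_eq_mul_integral (hmeas k) (integrable_comp_of_finite hZ (F k)).1,
    hprob k hk]

end Discrete

/-! ### Stochastic gradient ascent in the finite model -/

namespace ImportanceModel

variable {E V : Type*} [Fintype E] [Fintype (Set E)] [NormedAddCommGroup V]
  [InnerProductSpace ℝ V] [CompleteSpace V] (Q : ImportanceModel E V) {m N : ℕ}

/-- Stochastic gradient ascent with the batches `z`. -/
def iter (α : ℝ) (θ₀ : V) (z : ℕ → Fin m → E) : ℕ → V
  | 0 => θ₀
  | k + 1 => iter α θ₀ z k + α • Q.gradValueEst (iter α θ₀ z k) (z k)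

/-- Makes each iterate a function of finitely many batches, hence of a finitely valued variable. -/
lemma iter_congr (α : ℝ) (θ₀ : V) {z z' : ℕ → Fin m → E} {k : ℕ} (h : ∀ j < k, z j = z' j) :
    Q.iter α θ₀ z k = Q.iter α θ₀ z' k := by
  induction k with
  | zero => rfl
  | succ k ih => rw [iter, iter, ih fun j hj => h j (hj.trans k.lt_succ_self), h k k.lt_succ_self]

/-- The infinite sequence of batches that starts with the given `N` batches. -/
def unroll [Nonempty E] (ζ : Fin N × Fin m → E) : ℕ → Fin m → E := fun k i =>
  if h : k < N then ζ (⟨k, h⟩, i) else Classical.arbitrary E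

variable [Nonempty E] [MeasurableSpace E] [MeasurableSingletonClass E]
  {Ω : Type*} [MeasurableSpace Ω] {P : Measure Ω} [IsProbabilityMeasure P]
  {ν : Measure E} [IsProbabilityMeasure ν] {Y : ℕ → Fin m → Ω → E}

/-- The iterate depends on earlier batches only and is independent of batch `k`, so the error bound
at a fixed parameter applies conditionally on the past. -/
lemma integral_fresh_batch_error_le (hν : ∀ e, ν.real {e} = Q.weight e) (hm : 0 < m)
    (hlaw : ∀ k < N, ∀ i, HasLaw (Y k i) ν P)
    (hindep : iIndepFun (fun (ki : Fin N × Fin m) => Y ki.1 ki.2) P) (α : ℝ) (θ₀ : V)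
    {k : ℕ} (hk : k < N) :
    ∫ ω, ‖Q.gradValueEst (Q.iter α θ₀ (fun k i => Y k i ω) k) (fun i => Y k i ω) -
      Q.gradValue (Q.iter α θ₀ (fun k i => Y k i ω) k)‖ ^ 2 ∂P ≤
      Q.totalLen ^ 2 * (2 * Q.ratioBound ^ 2 * Q.scoreBound ^ 2 *
        (Q.derivBound ^ 2 + Q.derivLip ^ 2) / m) := by
  classical
  have hmeas : ∀ p : Fin N × Fin m, AEMeasurable (Y p.1 p.2) P := fun p =>
    (hlaw p.1 p.1.2 p.2).aemeasurable
  let S : Finset (Fin N × Fin m) := {p | p.1.1 < k}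
  let T : Finset (Fin N × Fin m) := {p | p.1.1 = k}
  have hST : Disjoint S T := Finset.disjoint_filter.2 fun p _ h h' => h.ne h'
  have hT : ∀ i : Fin m, ((⟨k, hk⟩, i) : Fin N × Fin m) ∈ T := fun i => by simp [T]
  let U : Ω → S → E := fun ω p => Y p.1.1 p.1.2 ω
  let W : Ω → Fin m → E := fun ω i => Y k i ω
  have hUW : IndepFun U W P :=
    (hindep.indepFun_finset₀ S T hST hmeas).comp (φ := id)
      (ψ := fun (u : T → E) i => u ⟨(⟨k, hk⟩, i), hT i⟩) .of_discrete .of_discrete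
  have hU : AEMeasurable U P := aemeasurable_pi_lambda _ fun p => hmeas p.1
  have hW : AEMeasurable W P := aemeasurable_pi_lambda _ fun i => hmeas (⟨k, hk⟩, i)
  have hWlaw : P.map W = Measure.pi fun _ => ν := by
    have h1 : iIndepFun (fun i : Fin m => Y k i) P :=
      hindep.precomp (g := fun i : Fin m => ((⟨k, hk⟩, i) : Fin N × Fin m))
        fun i j h => by simpa using h
    rw [(iIndepFun_iff_map_fun_eq_pi_map fun i => hmeas (⟨k, hk⟩, i)).1 h1]
    simp_rw [(hlaw k hk _).map_eq]
  -- The arbitrary values outside `S` are never read by iterate `k`.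
  let past : (S → E) → V := fun u => Q.iter α θ₀
    (unroll fun p => if h : p ∈ S then u ⟨p, h⟩ else Classical.arbitrary E) k
  have hpast : ∀ ω, Q.iter α θ₀ (fun k i => Y k i ω) k = past (U ω) := fun ω =>
    Q.iter_congr α θ₀ fun j hj => funext fun i => by
      simp [unroll, S, U, hj, hj.trans hk]
  simp_rw [hpast]
  refine hUW.integral_le_of_forall_integral_le hU hW
    (fun u w => ‖Q.gradValueEst (past u) w - Q.gradValue (past u)‖ ^ 2) fun u => ?_
  rw [hWlaw]
  exact Q.integral_norm_gradValueEst_sub_sq_le ν hν hm (past u)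

/-- Stochastic gradient ascent, stopped at an independent index uniform on `{1, …, N}`. -/
theorem integral_norm_gradValue_iter_sq_le (hν : ∀ e, ν.real {e} = Q.weight e) (hm : 0 < m)
    (hN : 0 < N) (hlaw : ∀ k < N, ∀ i, HasLaw (Y k i) ν P)
    (hindep : iIndepFun (fun (ki : Fin N × Fin m) => Y ki.1 ki.2) P)
    {R : Ω → ℕ} (hR : HasLaw R (uniformOn (Set.Icc 1 N)) P)
    (hRindep : IndepFun R (fun ω (ki : Fin N × Fin m) => Y ki.1 ki.2 ω) P)
    {α : ℝ} (hα : 0 < α) (θ₀ : V) {v : ℝ} (hv : ∀ θ, Q.value θ ≤ v) :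
    Integrable (fun ω => ‖Q.gradValue (Q.iter α θ₀ (fun k i => Y k i ω) (R ω))‖ ^ 2) P ∧
    ∫ ω, ‖Q.gradValue (Q.iter α θ₀ (fun k i => Y k i ω) (R ω))‖ ^ 2 ∂P ≤
      2 * (v - Q.value θ₀) / (N * α) + Q.totalLen ^ 2 * Q.ratioBound ^ 2 * Q.scoreBound ^ 2 *
        (α * Q.derivBound ^ 2 * Q.gradLip + 2 * (Q.derivBound ^ 2 + Q.derivLip ^ 2) / m) := by
  have hmeas : ∀ p : Fin N × Fin m, AEMeasurable (Y p.1 p.2) P := fun p =>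
    (hlaw p.1 p.1.2 p.2).aemeasurable
  let Z : Ω → Fin N × Fin m → E := fun ω p => Y p.1 p.2 ω
  have hZ : AEMeasurable Z P := aemeasurable_pi_lambda _ hmeas
  have hiter : ∀ k ≤ N, ∀ ω, Q.iter α θ₀ (fun k i => Y k i ω) k =
      Q.iter α θ₀ (unroll (Z ω)) k := fun k hk ω =>
    Q.iter_congr α θ₀ fun j hj => funext fun i => by simp [unroll, Z, hj.trans_le hk]
  have hint : ∀ (F : V → ℝ), ∀ k ≤ N,
      Integrable (fun ω => F (Q.iter α θ₀ (fun k i => Y k i ω) k)) P := fun F k hk => by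
    simp_rw [hiter k hk]
    exact integrable_comp_of_finite hZ fun ζ => F (Q.iter α θ₀ (unroll ζ) k)
  have hmem : ∀ᵐ ω ∂P, R ω ∈ Set.Icc 1 N := hR.ae_mem_Icc
  obtain ⟨hI, hE⟩ := integral_uniform_index hR hZ hRindep
    fun k ζ => ‖Q.gradValue (Q.iter α θ₀ (unroll ζ) k)‖ ^ 2
  have hae : (fun ω => ‖Q.gradValue (Q.iter α θ₀ (unroll (Z ω)) (R ω))‖ ^ 2) =ᵐ[P]
      fun ω => ‖Q.gradValue (Q.iter α θ₀ (fun k i => Y k i ω) (R ω))‖ ^ 2 := by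
    filter_upwards [hmem] with ω hω
    rw [hiter _ hω.2]
  refine ⟨hI.congr hae, ?_⟩
  have hnn : 0 ≤ 2 * (v - Q.value θ₀) / (N * α) :=
    div_nonneg (by linarith [hv θ₀]) (by positivity)
  have hK := Q.one_le_ratioBound θ₀
  have hK2 : 1 ≤ Q.ratioBound ^ 2 := one_le_pow₀ hK
  have hL := Q.gradLip_nonneg θ₀
  -- A small step allows the descent argument; a large one makes the claim follow from the uniform
  -- bound on the gradient.
  rcases le_total (α * Q.gradLip) 1 with hsmall | hlarge
  · rw [← integral_congr_ae hae, hE]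
    set B := Q.totalLen ^ 2 * (2 * Q.ratioBound ^ 2 * Q.scoreBound ^ 2 *
        (Q.derivBound ^ 2 + Q.derivLip ^ 2) / m) with hB
    let a : ℕ → ℝ := fun k => ∫ ω, ‖Q.gradValue (Q.iter α θ₀ (fun k i => Y k i ω) k)‖ ^ 2 ∂P
    let f : ℕ → ℝ := fun k => ∫ ω, Q.value (Q.iter α θ₀ (fun k i => Y k i ω) k) ∂P
    have ha : ∀ k, 0 ≤ a k := fun k => integral_nonneg fun ω => sq_nonneg _
    have hstep : ∀ k < N, α * a k ≤ 2 * (f (k + 1) - f k) + α * B := by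
      intro k hk
      have herr : Integrable (fun ω => ‖Q.gradValueEst (Q.iter α θ₀ (fun k i => Y k i ω) k)
          (fun i => Y k i ω) - Q.gradValue (Q.iter α θ₀ (fun k i => Y k i ω) k)‖ ^ 2) P := by
        have h : ∀ ω, (fun i => Y k i ω) = fun i => Z ω (⟨k, hk⟩, i) := fun ω => rfl
        simp_rw [h, hiter k hk.le]
        exact integrable_comp_of_finite hZ fun ζ => ‖Q.gradValueEst (Q.iter α θ₀ (unroll ζ) k)
          (fun i => ζ (⟨k, hk⟩, i)) - Q.gradValue (Q.iter α θ₀ (unroll ζ) k)‖ ^ 2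
      have hinc : Integrable (fun ω => Q.value (Q.iter α θ₀ (fun k i => Y k i ω) (k + 1)) -
          Q.value (Q.iter α θ₀ (fun k i => Y k i ω) k)) P :=
        (hint Q.value (k + 1) hk).sub (hint Q.value k hk.le)
      have h1 : ∫ ω, α * ‖Q.gradValue (Q.iter α θ₀ (fun k i => Y k i ω) k)‖ ^ 2 ∂P ≤
          ∫ ω, (2 * (Q.value (Q.iter α θ₀ (fun k i => Y k i ω) (k + 1)) -
            Q.value (Q.iter α θ₀ (fun k i => Y k i ω) k)) +
            α * ‖Q.gradValueEst (Q.iter α θ₀ (fun k i => Y k i ω) k)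
              (fun i => Y k i ω) - Q.gradValue (Q.iter α θ₀ (fun k i => Y k i ω) k)‖ ^ 2) ∂P :=
        integral_mono ((hint (fun θ => ‖Q.gradValue θ‖ ^ 2) k hk.le).const_mul α)
          ((hinc.const_mul 2).add (herr.const_mul α))
          fun ω => norm_gradient_sq_le_of_step Q.hasGradientAt_value Q.norm_gradValue_sub_le
            hα.le hsmall _ _
      rw [integral_const_mul, integral_add (hinc.const_mul 2) (herr.const_mul α), integral_const_mul,
        integral_const_mul, integral_sub (hint Q.value (k + 1) hk) (hint Q.value k hk.le)] at h1
      have h2 := mul_le_mul_of_nonneg_left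
        (Q.integral_fresh_batch_error_le hν hm hlaw hindep α θ₀ hk) hα.le
      linarith
    -- The random index can be `N`, after which there is no update. A fictitious exact gradient step
    -- from the last iterate bounds this term, since its value is at most `v`.
    have hlast : α * a N ≤ 2 * (v - f N) := by
      have h1 : ∫ ω, α * ‖Q.gradValue (Q.iter α θ₀ (fun k i => Y k i ω) N)‖ ^ 2 ∂P ≤
          ∫ ω, 2 * (v - Q.value (Q.iter α θ₀ (fun k i => Y k i ω) N)) ∂P := by
        refine integral_mono ((hint (fun θ => ‖Q.gradValue θ‖ ^ 2) N le_rfl).const_mul α)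
          (((integrable_const v).sub (hint Q.value N le_rfl)).const_mul 2) fun ω => ?_
        have h := norm_gradient_sq_le_of_step Q.hasGradientAt_value Q.norm_gradValue_sub_le
            hα.le hsmall (Q.iter α θ₀ (fun k i => Y k i ω) N)
            (Q.gradValue (Q.iter α θ₀ (fun k i => Y k i ω) N))
        rw [sub_self, norm_zero] at h
        linarith [hv (Q.iter α θ₀ (fun k i => Y k i ω) N +
          α • Q.gradValue (Q.iter α θ₀ (fun k i => Y k i ω) N))]
      rw [integral_const_mul, integral_const_mul, integral_sub (integrable_const v)
        (hint Q.value N le_rfl), integral_const, probReal_univ, one_smul] at h1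
      exact h1
    have hf0 : f 0 = Q.value θ₀ := by simp [f, iter]
    have hsum : α * ∑ k ∈ Finset.range N, a k ≤ 2 * (f N - f 0) + N * (α * B) := by
      rw [Finset.mul_sum, ← Finset.sum_range_sub, Finset.mul_sum]
      calc _ ≤ ∑ k ∈ Finset.range N, (2 * (f (k + 1) - f k) + α * B) :=
            Finset.sum_le_sum fun k hk => hstep k (Finset.mem_range.1 hk)
        _ = _ := by simp [Finset.sum_add_distrib]
    -- Telescoping controls the indices `0, …, N - 1`; the average runs over `1, …, N`. Adding the
    -- nonnegative term at `0` reconciles them.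
    have hIcc : ∑ k ∈ Finset.Icc 1 N, a k ≤ ∑ k ∈ Finset.range (N + 1), a k :=
      Finset.sum_le_sum_of_subset_of_nonneg (fun k hk => by
        simp only [Finset.mem_Icc, Finset.mem_range] at hk ⊢; omega) fun k _ _ => ha k
    have hconv : ∑ k ∈ Finset.Icc 1 N, ∫ ω, ‖Q.gradValue (Q.iter α θ₀ (unroll (Z ω)) k)‖ ^ 2 ∂P =
        ∑ k ∈ Finset.Icc 1 N, a k := Finset.sum_congr rfl fun k hk => by
      simp only [a]
      simp_rw [hiter k (Finset.mem_Icc.1 hk).2]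
    rw [hconv]
    rw [Finset.sum_range_succ] at hIcc
    have hN' : (0 : ℝ) < N := Nat.cast_pos.2 hN
    have h1 : α * ∑ k ∈ Finset.Icc 1 N, a k ≤ 2 * (v - Q.value θ₀) + N * (α * B) := by
      have := mul_le_mul_of_nonneg_left hIcc hα.le
      rw [mul_add] at this
      linarith
    calc (N : ℝ)⁻¹ * ∑ k ∈ Finset.Icc 1 N, a k
        = (α * ∑ k ∈ Finset.Icc 1 N, a k) / (N * α) := by field_simp
      _ ≤ (2 * (v - Q.value θ₀) + N * (α * B)) / (N * α) := by gcongr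
      _ = 2 * (v - Q.value θ₀) / (N * α) + B := by field_simp
      _ ≤ _ := by
        have : 0 ≤ Q.totalLen ^ 2 * Q.ratioBound ^ 2 * Q.scoreBound ^ 2 *
            (α * Q.derivBound ^ 2 * Q.gradLip) := by positivity
        have h3 : B = Q.totalLen ^ 2 * Q.ratioBound ^ 2 * Q.scoreBound ^ 2 *
            (2 * (Q.derivBound ^ 2 + Q.derivLip ^ 2) / m) := by rw [hB]; ring
        rw [h3, mul_add]
        linarith
  -- Here `1 ≤ ratioBound ^ 2` and `1 ≤ α * gradLip` inflate the uniform bound to the first term of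
  -- the claim.
  · calc _ ≤ ∫ _, (Q.totalLen * (Q.derivBound * Q.scoreBound)) ^ 2 ∂P :=
          integral_mono (hI.congr hae) (integrable_const _) fun ω =>
            pow_le_pow_left₀ (norm_nonneg _) (Q.norm_gradValue_le _) 2
      _ = (Q.totalLen * (Q.derivBound * Q.scoreBound)) ^ 2 * (1 * 1) := by simp
      _ ≤ (Q.totalLen * (Q.derivBound * Q.scoreBound)) ^ 2 *
          (Q.ratioBound ^ 2 * (α * Q.gradLip)) := by gcongr
      _ = Q.totalLen ^ 2 * Q.ratioBound ^ 2 * Q.scoreBound ^ 2 *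
          (α * Q.derivBound ^ 2 * Q.gradLip) := by ring
      _ ≤ _ := by
        have : 0 ≤ Q.totalLen ^ 2 * Q.ratioBound ^ 2 * Q.scoreBound ^ 2 *
            (2 * (Q.derivBound ^ 2 + Q.derivLip ^ 2) / m) := by positivity
        rw [mul_add]
        linarith

end ImportanceModel

/-! ### The decision process as an instance of the finite model -/

namespace EpisodicMDP

variable {S A : Type*} {d : ℕ}

section Score

variable (M : EpisodicMDP S A) {π : EuclideanSpace ℝ (Fin d) → StochPolicy S A}

/-- As a function of the parameter the ratio is a constant times the exponential of `∑ log π`. -/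
lemma hasGradientAt_isRatio (b : StochPolicy S A) (hpos : ∀ θ s a, 0 < (π θ s a).toReal)
    (hdiff : ∀ s a, Differentiable ℝ (fun θ => Real.log (π θ s a).toReal))
    (θ : EuclideanSpace ℝ (Fin d)) (τ : Trajectory S A) :
    HasGradientAt (fun η => M.isRatio (π η) b τ) (M.isRatio (π θ) b τ • M.score π θ τ) θ := by
  have hexp : ∀ η, M.isRatio (π η) b τ =
      Real.exp (∑ t ∈ Finset.range (M.len τ), Real.log (π η (τ t).1 (τ t).2).toReal) *
        ∏ t ∈ Finset.range (M.len τ), ((b (τ t).1 (τ t).2).toReal)⁻¹ := fun η => by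
    rw [Real.exp_sum, ← Finset.prod_mul_distrib]
    refine Finset.prod_congr rfl fun t _ => ?_
    rw [Real.exp_log (hpos _ _ _), div_eq_mul_inv]
  rw [hasGradientAt_iff_hasFDerivAt]
  have h := ((HasFDerivAt.fun_sum (u := Finset.range (M.len τ)) fun t _ =>
    (hdiff (τ t).1 (τ t).2 θ).hasGradientAt.hasFDerivAt).exp).mul_const
    (∏ t ∈ Finset.range (M.len τ), ((b (τ t).1 (τ t).2).toReal)⁻¹)
  simp_rw [hexp]
  refine h.congr_fderiv ?_
  rw [smul_smul, score, map_smul, map_sum, mul_comm]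

lemma isRatio_nonneg (π b : StochPolicy S A) (τ : Trajectory S A) : 0 ≤ M.isRatio π b τ :=
  Finset.prod_nonneg fun _ _ => div_nonneg ENNReal.toReal_nonneg ENNReal.toReal_nonneg

lemma norm_score_le {C : ℝ} (θ : EuclideanSpace ℝ (Fin d))
    (hC : ∀ s a, ‖gradient (fun η => Real.log (π η s a).toReal) θ‖ ≤ C) (τ : Trajectory S A) :
    ‖M.score π θ τ‖ ≤ M.len τ * C := by
  refine (norm_sum_le_of_le _ fun t _ => hC _ _).trans ?_
  simp

lemma differentiable_score
    (hdiff2 : ∀ s a, Differentiable ℝ (gradient (fun η => Real.log (π η s a).toReal)))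
    (τ : Trajectory S A) : Differentiable ℝ fun θ => M.score π θ τ :=
  Differentiable.fun_sum fun _ _ => hdiff2 _ _

lemma norm_fderiv_score_le {C : ℝ} (θ : EuclideanSpace ℝ (Fin d))
    (hdiff2 : ∀ s a, Differentiable ℝ (gradient (fun η => Real.log (π η s a).toReal)))
    (hC : ∀ s a, ‖fderiv ℝ (gradient (fun η => Real.log (π η s a).toReal)) θ‖ ≤ C)
    (τ : Trajectory S A) : ‖fderiv ℝ (fun η => M.score π η τ) θ‖ ≤ M.len τ * C := by
  have h : fderiv ℝ (fun η => M.score π η τ) θ = ∑ t ∈ Finset.range (M.len τ),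
      fderiv ℝ (gradient (fun η => Real.log (π η (τ t).1 (τ t).2).toReal)) θ :=
    fderiv_fun_sum fun t _ => hdiff2 _ _ θ
  rw [h]
  refine (norm_sum_le_of_le _ fun t _ => hC _ _).trans ?_
  simp

end Score

variable [Fintype S] [Fintype A] [MeasurableSpace S] [MeasurableSingletonClass S]
  [MeasurableSpace A] [MeasurableSingletonClass A]

/-- The standing assumptions on the policies, the distortion and the episodes. -/
structure OffPolicyAssumptions (M : EpisodicMDP S A)
    (π : EuclideanSpace ℝ (Fin d) → StochPolicy S A) (b : StochPolicy S A) (g : ℝ → ℝ)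
    (Md Mh Mg' Mg'' Me Ms : ℝ) : Prop where
  pos : ∀ θ s a, 0 < (π θ s a).toReal
  differentiable_log : ∀ s a, Differentiable ℝ (fun θ => Real.log (π θ s a).toReal)
  norm_gradient_log_le : ∀ θ s a, ‖gradient (fun η => Real.log (π η s a).toReal) θ‖ ≤ Md
  differentiable_gradient_log : ∀ s a,
    Differentiable ℝ (gradient (fun η => Real.log (π η s a).toReal))
  norm_fderiv_gradient_log_le : ∀ θ s a,
    ‖fderiv ℝ (gradient (fun η => Real.log (π η s a).toReal)) θ‖ ≤ Mh
  isDistortion : IsDistortion g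
  differentiableOn : DifferentiableOn ℝ g (Set.Ioo 0 1)
  abs_deriv_le : ∀ t ∈ Set.Ioo (0 : ℝ) 1, |deriv g t| ≤ Mg'
  differentiableOn_deriv : DifferentiableOn ℝ (deriv g) (Set.Ioo 0 1)
  abs_deriv_deriv_le : ∀ t ∈ Set.Ioo (0 : ℝ) 1, |deriv (deriv g) t| ≤ Mg''
  absolutelyContinuous : ∀ θ s a, b s a = 0 → π θ s a = 0
  len_le : ∀ᵐ τ ∂(M.law b M.init), M.Terminates τ ∧ (M.len τ : ℝ) ≤ Me
  isRatio_le : ∀ θ, ∀ᵐ τ ∂(M.law b M.init), M.isRatio (π θ) b τ ≤ Ms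

namespace OffPolicyAssumptions

variable {M : EpisodicMDP S A} {π : EuclideanSpace ℝ (Fin d) → StochPolicy S A}
  {b : StochPolicy S A} {g : ℝ → ℝ} {Md Mh Mg' Mg'' Me Ms : ℝ}

lemma behaviour_ne_zero
    (H : M.OffPolicyAssumptions π b g Md Mh Mg' Mg'' Me Ms) (s : S) (a : A) : b s a ≠ 0 := fun h =>
  (H.pos 0 s a).ne' (by rw [H.absolutelyContinuous 0 s a h, ENNReal.toReal_zero])

lemma maxLen_nonneg (H : M.OffPolicyAssumptions π b g Md Mh Mg' Mg'' Me Ms) :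
    0 ≤ Me := by
  obtain ⟨τ, -, hτ⟩ := H.len_le.exists
  exact (Nat.cast_nonneg _).trans hτ

lemma ae_terminates (H : M.OffPolicyAssumptions π b g Md Mh Mg' Mg'' Me Ms) :
    ∀ᵐ τ ∂M.law b M.init, ∃ t ≤ ⌊Me⌋₊, (τ t).1 = M.terminal := by
  filter_upwards [H.len_le] with τ hτ
  exact ⟨M.len τ, Nat.le_floor hτ.2, M.fst_len hτ.1⟩

lemma nonempty_action (b : StochPolicy S A) (s : S) : Nonempty A :=
  ⟨(b s).support_nonempty.choose⟩

lemma gradBound_nonneg (H : M.OffPolicyAssumptions π b g Md Mh Mg' Mg'' Me Ms) : 0 ≤ Md :=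
  have := nonempty_action b M.init
  (norm_nonneg _).trans (H.norm_gradient_log_le 0 M.init (Classical.arbitrary A))

lemma hessBound_nonneg (H : M.OffPolicyAssumptions π b g Md Mh Mg' Mg'' Me Ms) : 0 ≤ Mh :=
  have := nonempty_action b M.init
  (norm_nonneg _).trans (H.norm_fderiv_gradient_log_le 0 M.init (Classical.arbitrary A))

lemma len_freeze_mul_le (H : M.OffPolicyAssumptions π b g Md Mh Mg' Mg'' Me Ms)
    {C : ℝ} (hC : 0 ≤ C) (e : Finset.Iic ⌊Me⌋₊ → S × A) :
    M.len (freeze e) * C ≤ Me * C :=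
  mul_le_mul_of_nonneg_right ((Nat.cast_le.2 (M.len_freeze_le e)).trans
    (Nat.floor_le H.maxLen_nonneg)) hC

/-- An almost sure bound holds at every atom, here at every prefix of positive mass. -/
lemma isRatio_freeze_le (H : M.OffPolicyAssumptions π b g Md Mh Mg' Mg'' Me Ms)
    (θ : EuclideanSpace ℝ (Fin d)) (e : Finset.Iic ⌊Me⌋₊ → S × A)
    (he : (M.prefixLaw b M.init ⌊Me⌋₊).real {e} ≠ 0) : M.isRatio (π θ) b (freeze e) ≤ Ms := by
  have h : ∀ᵐ e ∂M.prefixLaw b M.init ⌊Me⌋₊, M.isRatio (π θ) b (freeze e) ≤ Ms := by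
    refine (ae_map_iff (Preorder.measurable_frestrictLe _).aemeasurable .of_discrete).2 ?_
    filter_upwards [H.isRatio_le θ, H.ae_terminates] with τ hτ ht
    exact (M.isRatio_frozen (π θ) b ht).trans_le hτ
  exact ae_iff_of_countable.1 h e fun h0 => he (by rw [measureReal_def, h0, ENNReal.toReal_zero])

lemma derivWithin_bounds (H : M.OffPolicyAssumptions π b g Md Mh Mg' Mg'' Me Ms) :
    (∀ t ∈ Set.Icc (0 : ℝ) 1,
      HasDerivWithinAt g (derivWithin g (Set.Icc 0 1) t) (Set.Icc 0 1) t) ∧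
    (∀ t ∈ Set.Icc (0 : ℝ) 1, |derivWithin g (Set.Icc 0 1) t| ≤ Mg') ∧
    ∀ t ∈ Set.Icc (0 : ℝ) 1, ∀ s ∈ Set.Icc (0 : ℝ) 1,
      |derivWithin g (Set.Icc 0 1) t - derivWithin g (Set.Icc 0 1) s| ≤ Mg'' * |t - s| :=
  H.isDistortion.derivWithin_bounds H.differentiableOn H.abs_deriv_le
  H.differentiableOn_deriv H.abs_deriv_deriv_le

/-- The finite model of the episodes generated by `b`, observed up to their maximal length. -/
def model (H : M.OffPolicyAssumptions π b g Md Mh Mg' Mg'' Me Ms) :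
    ImportanceModel (Finset.Iic ⌊Me⌋₊ → S × A) (EuclideanSpace ℝ (Fin d)) where
  weight e := (M.prefixLaw b M.init ⌊Me⌋₊).real {e}
  weight_nonneg _ := measureReal_nonneg
  sum_weight := by
    have h := integral_fintype (μ := M.prefixLaw b M.init ⌊Me⌋₊) 
      (f := fun _ => (1 : ℝ)) .of_finite
    simpa only [integral_const, probReal_univ, smul_eq_mul, mul_one] using h.symm
  ratio θ e := M.isRatio (π θ) b (freeze e)
  ratio_nonneg θ e := M.isRatio_nonneg _ _ _
  sum_ratio _ := sum_prefixLaw_mul_isRatio_eq_one H.behaviour_ne_zero H.ae_terminates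
  ratioBound := Ms
  ratio_le := H.isRatio_freeze_le
  score θ e := M.score π θ (freeze e)
  hasGradientAt_ratio θ e := M.hasGradientAt_isRatio b H.pos H.differentiable_log θ _
  scoreBound := Me * Md
  norm_score_le θ e := (M.norm_score_le θ (H.norm_gradient_log_le θ) _).trans
    (H.len_freeze_mul_le H.gradBound_nonneg e)
  differentiable_score e := M.differentiable_score H.differentiable_gradient_log _
  hessBound := Me * Mh
  norm_fderiv_score_le θ e := (M.norm_fderiv_score_le θ H.differentiable_gradient_log
    (H.norm_fderiv_gradient_log_le θ) _).trans
    (H.len_freeze_mul_le H.hessBound_nonneg e)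
  len := sliceLength (fun e => M.ret (freeze e)) (-M.retBound) M.retBound
  len_nonneg := sliceLength_nonneg _ _ _
  g := g
  g' := derivWithin g (Set.Icc 0 1)
  hasDerivWithinAt_g := H.derivWithin_bounds.1
  derivBound := Mg'
  abs_g'_le := H.derivWithin_bounds.2.1
  derivLip := Mg''
  abs_g'_sub_le := H.derivWithin_bounds.2.2

end OffPolicyAssumptions

end EpisodicMDP

/-! ### Transfer of objective, estimator and iterates to the model -/

namespace EpisodicMDP

variable {S A : Type*} {d : ℕ}
variable [Fintype S] [Fintype A] [MeasurableSpace S] [MeasurableSingletonClass S]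
  [MeasurableSpace A] [MeasurableSingletonClass A]

lemma retBound_pos (M : EpisodicMDP S A) : 0 < M.retBound :=
  div_pos M.rMax_pos (sub_pos.2 M.discount_lt_one)

namespace OffPolicyAssumptions

variable {M : EpisodicMDP S A} {π : EuclideanSpace ℝ (Fin d) → StochPolicy S A}
  {b : StochPolicy S A} {g : ℝ → ℝ} {Md Mh Mg' Mg'' Me Ms : ℝ}

lemma retCDF_eq (H : M.OffPolicyAssumptions π b g Md Mh Mg' Mg'' Me Ms)
    (θ : EuclideanSpace ℝ (Fin d)) (x : ℝ) :
    M.retCDF (π θ) x = H.model.cdf θ {e | M.ret (freeze e) ≤ x} :=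
  retCDF_eq_sum H.behaviour_ne_zero H.ae_terminates x

lemma totalLen_eq (H : M.OffPolicyAssumptions π b g Md Mh Mg' Mg'' Me Ms) :
    H.model.totalLen = 2 * M.retBound := by
  have h := sum_sliceLength (fun e : Finset.Iic ⌊Me⌋₊ → S × A => M.ret (freeze e))
    (neg_le_self M.retBound_pos.le)
  refine h.trans (by ring)

/-- The `-1` in the integral over `[-M_r, 0]` contributes `-M_r`; the rest is one integral of `g (1
- F)` over `[-M_r, M_r]`, a sum over slices. -/
lemma drm_eq (H : M.OffPolicyAssumptions π b g Md Mh Mg' Mg'' Me Ms)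
    (θ : EuclideanSpace ℝ (Fin d)) :
    M.drm g (π θ) = H.model.value θ - M.retBound := by
  let φ : Set (Finset.Iic ⌊Me⌋₊ → S × A) → ℝ := fun c => g (1 - H.model.cdf θ c)
  have hint : ∀ a c, IntervalIntegrable
      (fun x => φ {e | M.ret (freeze e) ≤ x}) volume a c := fun a c =>
    intervalIntegrable_slice _ a c φ
  have hv := integral_slice (fun e : Finset.Iic ⌊Me⌋₊ → S × A => M.ret (freeze e))
    (neg_le_self M.retBound_pos.le) φ
  rw [← intervalIntegral.integral_add_adjacent_intervals (hint _ 0) (hint 0 _)] at hv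
  simp only [drm, H.retCDF_eq]
  rw [intervalIntegral.integral_sub (hint _ _) intervalIntegrable_const]
  have : H.model.value θ = _ := hv.symm
  rw [this, intervalIntegral.integral_const]
  simp only [φ, smul_eq_mul, mul_one]
  ring

lemma hasGradientAt_drm (H : M.OffPolicyAssumptions π b g Md Mh Mg' Mg'' Me Ms)
    (θ : EuclideanSpace ℝ (Fin d)) :
    HasGradientAt (fun θ => M.drm g (π θ)) (H.model.gradValue θ) θ := by
  simp_rw [H.drm_eq]
  exact hasGradientAt_iff_hasFDerivAt.2
    ((H.model.hasGradientAt_value θ).hasFDerivAt.sub_const M.retBound)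

lemma drm_le (H : M.OffPolicyAssumptions π b g Md Mh Mg' Mg'' Me Ms)
    (θ : EuclideanSpace ℝ (Fin d)) : M.drm g (π θ) ≤ M.retBound := by
  rw [H.drm_eq]
  have h : H.model.value θ ≤ H.model.totalLen := Finset.sum_le_sum fun c _ =>
    mul_le_of_le_one_right (H.model.len_nonneg c)
      (H.isDistortion.mapsTo (H.model.one_sub_cdf_mem θ c)).2
  rw [H.totalLen_eq] at h
  linarith

variable {m : ℕ}

/-- Return, ratio and score of a terminated episode are read off its prefix, so the integrand
depends on `x` only through the slice. -/
lemma drmGradEst_eq (H : M.OffPolicyAssumptions π b g Md Mh Mg' Mg'' Me Ms)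
    (θ : EuclideanSpace ℝ (Fin d)) {τ : Fin m → Trajectory S A}
    (hτ : ∀ i, ∃ t ≤ ⌊Me⌋₊, (τ i t).1 = M.terminal) :
    M.drmGradEst g π b θ τ = H.model.gradValueEst θ
      fun i => Preorder.frestrictLe (π := fun _ => S × A) ⌊Me⌋₊ (τ i) := by
  set y : Fin m → Finset.Iic ⌊Me⌋₊ → S × A :=
    fun i => Preorder.frestrictLe (π := fun _ => S × A) ⌊Me⌋₊ (τ i)
  have h1 : ∀ x, M.cdfEst (π θ) b τ x = H.model.cdfEst θ y {e | M.ret (freeze e) ≤ x} := by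
    intro x
    rw [cdfEst, ImportanceModel.cdfEst]
    congr 2
    refine Finset.sum_congr rfl fun i _ => ?_
    simp only [Set.indicator_apply, Set.mem_ofPred_eq, y, M.ret_frozen (hτ i), model,
      M.isRatio_frozen _ _ (hτ i)]
  have h2 : ∀ x, M.gradCdfEst π b θ τ x =
      H.model.gradCdfEst θ y {e | M.ret (freeze e) ≤ x} := by
    intro x
    rw [gradCdfEst, ImportanceModel.gradCdfEst]
    congr 1
    refine Finset.sum_congr rfl fun i _ => ?_
    simp only [Set.indicator_apply, Set.mem_ofPred_eq, y, M.ret_frozen (hτ i), model,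
      M.isRatio_frozen _ _ (hτ i), M.score_frozen _ _ (hτ i)]
  have h3 := integral_slice (fun e : Finset.Iic ⌊Me⌋₊ → S × A => M.ret (freeze e))
    (neg_le_self M.retBound_pos.le) fun c =>
      -(H.model.g' (1 - H.model.cdfEst θ y c) • H.model.gradCdfEst θ y c)
  rw [intervalIntegral.integral_neg] at h3
  simp only [drmGradEst, h1, h2]
  exact h3

lemma offPolicyIter_eq (H : M.OffPolicyAssumptions π b g Md Mh Mg' Mg'' Me Ms) (α : ℝ)
    (θ₀ : EuclideanSpace ℝ (Fin d)) {τ : ℕ → Fin m → Trajectory S A} {N : ℕ}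
    (hτ : ∀ k < N, ∀ i, ∃ t ≤ ⌊Me⌋₊, (τ k i t).1 = M.terminal) :
    ∀ k ≤ N, M.offPolicyIter g π b α θ₀ τ k = H.model.iter α θ₀
      (fun k i => Preorder.frestrictLe (π := fun _ => S × A) ⌊Me⌋₊ (τ k i)) k := by
  intro k hk
  induction k with
  | zero => rfl
  | succ k ih =>
    rw [offPolicyIter, ImportanceModel.iter, ih (Nat.le_of_succ_le hk), H.drmGradEst_eq _ (hτ k hk)]

lemma gradLip_eq (H : M.OffPolicyAssumptions π b g Md Mh Mg' Mg'' Me Ms) :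
    H.model.gradLip = drmLipConst M.retBound Me Md Mh Mg' Mg'' := by
  rw [ImportanceModel.gradLip, H.totalLen_eq, drmLipConst]
  simp only [model]
  ring

/-- The model yields a smaller constant than the one claimed, as `exp 1` and `Ms ^ 2` are at least
`1`. -/
lemma error_bound_le (H : M.OffPolicyAssumptions π b g Md Mh Mg' Mg'' Me Ms) (m : ℕ) :
    2 * (Mg' ^ 2 + Mg'' ^ 2) / (m : ℝ) ≤
      8 * (Real.exp 1 ^ 2 * Mg' ^ 2 + Mg'' ^ 2 * Ms ^ 2) / m := by
  have h1 : (1 : ℝ) ≤ Real.exp 1 ^ 2 := one_le_pow₀ (Real.one_le_exp zero_le_one)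
  have h2 : (1 : ℝ) ≤ Ms ^ 2 := one_le_pow₀ (H.model.one_le_ratioBound 0)
  have h3 := mul_le_mul_of_nonneg_right h1 (sq_nonneg Mg')
  have h4 := mul_le_mul_of_nonneg_left h2 (sq_nonneg Mg'')
  have h5 := sq_nonneg Mg'
  have h6 := sq_nonneg Mg''
  refine div_le_div_of_nonneg_right ?_ m.cast_nonneg
  linarith

end OffPolicyAssumptions

end EpisodicMDP

end

theorem mainTheorem2 {S A : Type*} [Finite S] [Finite A]
    [MeasurableSpace S] [MeasurableSingletonClass S]
    [MeasurableSpace A] [MeasurableSingletonClass A]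
    (M : EpisodicMDP S A) {d : ℕ}
    (π : EuclideanSpace ℝ (Fin d) → StochPolicy S A) (b : StochPolicy S A)
    (g : ℝ → ℝ) (Md Mh Mg' Mg'' Me Ms : ℝ)
    -- the policies are proper
    (hproper : ∃ K : ℕ, 0 < K ∧ ∀ θ s,
      (M.law (π θ) s).real {τ | (τ K).1 ≠ M.terminal} < 1)
    (hproper_b : ∃ K : ℕ, 0 < K ∧ ∀ s, (M.law b s).real {τ | (τ K).1 ≠ M.terminal} < 1)
    -- log-policies are well defined and twice differentiable, with bounded derivatives
    (hpos : ∀ θ s a, 0 < (π θ s a).toReal)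
    (hdiff : ∀ s a, Differentiable ℝ (fun θ => Real.log (π θ s a).toReal))
    (hMd : ∀ θ s a, ‖gradient (fun η => Real.log (π η s a).toReal) θ‖ ≤ Md)
    (hdiff2 : ∀ s a, Differentiable ℝ (gradient (fun η => Real.log (π η s a).toReal)))
    (hMh : ∀ θ s a,
      ‖fderiv ℝ (gradient (fun η => Real.log (π η s a).toReal)) θ‖ ≤ Mh)
    -- the distortion function, with bounded first and second derivatives on the open interval
    (hg : IsDistortion g)
    (hg1 : DifferentiableOn ℝ g (Set.Ioo 0 1))
    (hMg1 : ∀ t ∈ Set.Ioo (0 : ℝ) 1, |deriv g t| ≤ Mg')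
    (hg2 : DifferentiableOn ℝ (deriv g) (Set.Ioo 0 1))
    (hMg2 : ∀ t ∈ Set.Ioo (0 : ℝ) 1, |deriv (deriv g) t| ≤ Mg'')
    -- absolute continuity of the target policies with respect to the behaviour policy
    (habs : ∀ θ s a, b s a = 0 → π θ s a = 0)
    -- the bounds on the episode length and on the importance sampling ratio
    (hMe : ∀ᵐ τ ∂(M.law b M.init), M.Terminates τ ∧ (M.len τ : ℝ) ≤ Me)
    (hMs : ∀ θ, ∀ᵐ τ ∂(M.law b M.init), M.isRatio (π θ) b τ ≤ Ms)
    -- the algorithm: `N` iterations, batches of `m` independent episodes generated by `b`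
    (N m : ℕ) (hN : 0 < N) (hm : 0 < m) (α : ℝ) (hα : 0 < α)
    (θ₀ : EuclideanSpace ℝ (Fin d))
    {Ω : Type*} [MeasurableSpace Ω] (P : Measure Ω) [IsProbabilityMeasure P]
    (X : ℕ → Fin m → Ω → Trajectory S A)
    (hlaw : ∀ k < N, ∀ i, HasLaw (X k i) (M.law b M.init) P)
    (hindep : iIndepFun (fun (ki : Fin N × Fin m) => X ki.1 ki.2) P)
    (R : Ω → ℕ) (hR : HasLaw R (uniformOn (Set.Icc 1 N)) P)
    (hRindep : IndepFun R (fun ω (ki : Fin N × Fin m) => X ki.1 ki.2 ω) P) :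
    Differentiable ℝ (fun θ => M.drm g (π θ)) ∧
    BddAbove (Set.range fun θ => M.drm g (π θ)) ∧
    Integrable (fun ω => ‖gradient (fun θ => M.drm g (π θ))
      (M.offPolicyIter g π b α θ₀ (fun k i => X k i ω) (R ω))‖ ^ 2) P ∧
    ∫ ω, ‖gradient (fun θ => M.drm g (π θ))
      (M.offPolicyIter g π b α θ₀ (fun k i => X k i ω) (R ω))‖ ^ 2 ∂P ≤
      2 * ((⨆ θ, M.drm g (π θ)) - M.drm g (π θ₀)) / (N * α) +
      4 * M.retBound ^ 2 * Ms ^ 2 * Me ^ 2 * Md ^ 2 *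
        (α * Mg' ^ 2 * drmLipConst M.retBound Me Md Mh Mg' Mg'' +
          8 * (Real.exp 1 ^ 2 * Mg' ^ 2 + Mg'' ^ 2 * Ms ^ 2) / m) := by
  classical
  cases nonempty_fintype S
  cases nonempty_fintype A
  have H : M.OffPolicyAssumptions π b g Md Mh Mg' Mg'' Me Ms :=
    ⟨hpos, hdiff, hMd, hdiff2, hMh, hg, hg1, hMg1, hg2, hMg2, habs, hMe, hMs⟩
  have hbdd : BddAbove (Set.range fun θ => M.drm g (π θ)) :=
    ⟨M.retBound, Set.forall_mem_range.2 H.drm_le⟩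
  have hgrad : gradient (fun θ => M.drm g (π θ)) = H.model.gradValue :=
    funext fun θ => (H.hasGradientAt_drm θ).gradient
  refine ⟨fun θ => (H.hasGradientAt_drm θ).differentiableAt, hbdd, ?_⟩
  have hA := EpisodicMDP.OffPolicyAssumptions.nonempty_action b M.init
  have : Nonempty (Finset.Iic ⌊Me⌋₊ → S × A) := ⟨fun _ => (M.init, Classical.arbitrary A)⟩
  let Y : ℕ → Fin m → Ω → Finset.Iic ⌊Me⌋₊ → S × A := fun k i ω =>
    Preorder.frestrictLe (π := fun _ => S × A) ⌊Me⌋₊ (X k i ω)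
  have hpre : Measurable (Preorder.frestrictLe (π := fun _ => S × A) ⌊Me⌋₊) :=
    Preorder.measurable_frestrictLe _
  have hYlaw : ∀ k < N, ∀ i, HasLaw (Y k i) (M.prefixLaw b M.init ⌊Me⌋₊) P := fun k hk i =>
    HasLaw.fun_comp ⟨hpre.aemeasurable, rfl⟩ (hlaw k hk i)
  have hYindep : iIndepFun (fun ki : Fin N × Fin m => Y ki.1 ki.2) P :=
    hindep.comp (fun _ => Preorder.frestrictLe (π := fun _ => S × A) ⌊Me⌋₊) fun _ => hpre
  have hψ : Measurable fun (x : Fin N × Fin m → Trajectory S A) ki =>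
      Preorder.frestrictLe (π := fun _ => S × A) ⌊Me⌋₊ (x ki) :=
    measurable_pi_lambda _ fun ki => hpre.comp (measurable_pi_apply ki)
  have hYR : IndepFun R (fun ω (ki : Fin N × Fin m) => Y ki.1 ki.2 ω) P :=
    hRindep.comp measurable_id hψ
  have hterm : ∀ᵐ ω ∂P, ∀ k < N, ∀ i, ∃ t ≤ ⌊Me⌋₊, (X k i ω t).1 = M.terminal := by
    refine ae_all_iff.2 fun k => ae_all_iff.2 fun hk => ae_all_iff.2 fun i => ?_
    have h := H.ae_terminates
    rw [← (hlaw k hk i).map_eq] at h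
    exact ae_of_ae_map (hlaw k hk i).aemeasurable h
  have hae : (fun ω => ‖H.model.gradValue (H.model.iter α θ₀ (fun k i => Y k i ω) (R ω))‖ ^ 2) =ᵐ[P]
      fun ω => ‖H.model.gradValue
        (M.offPolicyIter g π b α θ₀ (fun k i => X k i ω) (R ω))‖ ^ 2 := by
    filter_upwards [hterm, hR.ae_mem_Icc] with ω hω hRω
    rw [H.offPolicyIter_eq α θ₀ hω _ hRω.2]
  -- The model's value exceeds the risk measure by `M_r`, hence the shift in `v`; it cancels in `v -
  -- value θ₀`.
  obtain ⟨hI, hE⟩ := H.model.integral_norm_gradValue_iter_sq_le (fun _ => rfl) hm hN hYlaw hYindep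
    hR hYR hα θ₀ (v := (⨆ θ, M.drm g (π θ)) + M.retBound) fun θ => by
      have := le_ciSup hbdd θ
      simp only [H.drm_eq θ] at this
      linarith
  rw [hgrad]
  refine ⟨hI.congr hae, ?_⟩
  rw [← integral_congr_ae hae]
  refine hE.trans (add_le_add (le_of_eq ?_) ?_)
  · rw [H.drm_eq θ₀]
    ring
  · rw [H.gradLip_eq, H.totalLen_eq]
    have h := H.error_bound_le m
    calc _ = 4 * M.retBound ^ 2 * Ms ^ 2 * Me ^ 2 * Md ^ 2 *
          (α * Mg' ^ 2 * drmLipConst M.retBound Me Md Mh Mg' Mg'' +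
            2 * (Mg' ^ 2 + Mg'' ^ 2) / m) := by
          simp only [EpisodicMDP.OffPolicyAssumptions.model]; ring
      _ ≤ _ := by gcongr
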